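/- **Model.** There are $n$ processes $1,\dots,n$, each with a local dispatcher $d_i$ (processes and dispatchers are the *agents*), and a set of shared variables. A TSO state consists of a memory $m$ and a FIFO store buffer for each process. A process $i$ may write, $W[x,v]$ (append $\langle x,v\rangle$ to its buffer); read, $R[x]$ (the newest entry for $x$ in its own buffer if there is one, an event $RfB$; otherwise $m(x)$, an event $RfM$); fence, $F$ (enabled only if its buffer is empty); read-modify-write, $RMW[x,v_{exp},v_{new}]$ (enabled only if its buffer is empty and $m(x)=v_{exp}$; sets $m(x):=v_{new}$); or perform an internal action, such as returning from its pending operation. The action $prop$ of $d_i$, enabled if $i$'s buffer is nonempty, removes the oldest entry $\langle x,v\rangle$ of $i$'s buffer and sets $m(x):=v$. The *memory accesses* of $x$ are the events $RfM$, $RMW$ and $prop$ on $x$. A local state is the list of the records of the process's past non-null actions (a read is recorded with its value, but without distinguishing $RfB$ from $RfM$) and of the invocations it received. A *run* of a protocol $P$ (a nonempty set of allowed actions, possibly including the null action, for every process and local state, together with an initial memory) is an infinite sequence of global states $r(0),r(1),\dots$, starting with empty buffers and empty local states. Here $r(t+1)$ results from $r(t)$ by a joint action: an action (or null) of every process, allowed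 by $P$ and enabled at $r(t)$; $prop$ or null for every dispatcher, enabled at $r(t)$; and at most one operation invocation by the environment at each process that has no pending operation. These are executed in this order. No two actions of a joint action may conflict; two actions conflict if both are memory accesses of the same variable, not both are $RfM$, and they are not a $prop$ of $d_i$ together with an $RfM$ of $i$. The action of agent $b$ in this joint action is the action at the *node* $\langle b,t\rangle$. The relation *occurs-before*, $\rightsquigarrow_r$, is the least transitive relation on nodes such that for all $t<t'$: 1. $\langle b,t\rangle\rightsquigarrow_r\langle b,t'\rangle$ for every agent $b$; 2. $\langle i,t\rangle\rightsquigarrow_r\langle d_i,t'\rangle$ if an item written, or read from the buffer, at $\langle i,t\rangle$ is propagated at $\langle d_i,t'\rangle$; 3. $\langle b,t\rangle\rightsquigarrow_r\langle c,t'\rangle$ if the actions at both nodes are memory accesses of the same variable, except if both are $RfM$, or if $b=d_i$, $c=i$, the first is a $prop$ and the second an $RfM$; 4. $\langle d_i,t\rangle\rightsquigarrow_r\langle i,t'\rangle$ if the action at $\langle d_i,t\rangle$ is a $prop$ and the one at $\langle i,t'\rangle$ is an $F$ or $RMW$. For an operation $X$ of process $i$ that is invoked in the step from $r(t)$ to $r(t+1)$,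 let $X.s=\langle i,t\rangle$; if $X$ completes, and its return is performed in the step from $r(t'-1)$ to $r(t')$, let $X.e=\langle i,t'\rangle$. Operation $X$ *precedes* $Y$, $X<_rY$, if $X$ completes and the time of $X.e$ is smaller than the time of $Y.s$. Operation $X$ *occurs before* a completed operation $Y$, $X\rightsquigarrow_rY$, if $X.s\rightsquigarrow_r Y.e$. The *snapshot* object over a value set $W$ has operations $\mathrm{update}(w)$, $w\in W$, returning $\mathtt{ack}$, and $\mathrm{scan}$, returning a vector $V$ indexed by the processes, where $V(k)$ is the value of the last preceding update by process $k$, or $\bot\notin W$ if there is none. Only runs in which no process is asked to update with the same value more than once are considered. A protocol is a *linearizable snapshot implementation* if, for each such run, the history up to each time is linearizable: after completing some of the pending operations with responses and discarding the other pending ones, its operations can be arranged in a sequence that satisfies the sequential specification, preserves the order of operations of each process, and extends $<_r$. **Theorem (update to scan).** Let $r$ be a run of a linearizable snapshot implementation in TSO in which no process updates with the same value more than once, and in which no process reads an item from its buffer in the same round in which its dispatcher propagates that very item. (a) If $\mathrm{update}_i(v)<_r\mathrm{scan}_j$ and $\mathrm{scan}_j$ completes in $r$, then $\mathrm{update}_i(v)\rightsquigarrow_r\mathrm{scan}_j$.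 (b) If $\mathrm{scan}_i<_r\mathrm{update}_j(v)$ and $\mathrm{update}_j(v)$ completes in $r$, then $\mathrm{scan}_i\rightsquigarrow_r\mathrm{update}_j(v)$. -/

import Mathlib

namespace TSO

/-! ### Actions, events, states -/

/-- Non-null actions of a process; the null action is `none : Option (Act ..)`.
`ret ρ` is the response of the pending operation with result `ρ`, and `internal` covers all
other internal actions. -/
inductive Act (Var Val Lab Resp : Type*) where
  | read (x : Var)
  | write (x : Var) (v : Val)
  | fence
  | rmw (x : Var) (vexp vnew : Val)
  | internal (a : Lab)
  | ret (ρ : Resp)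

/-- Records kept in local states. A read is recorded without telling whether the value came from
the buffer or from memory. -/
inductive Record (Var Val Lab Op Resp : Type*) where
  | read (x : Var) (v : Val)
  | write (x : Var) (v : Val)
  | fence
  | rmw (x : Var) (vexp vnew : Val)
  | internal (a : Lab)
  | ret (ρ : Resp)
  | invoke (o : Op)

/-- Store buffer entry `⟨x, v⟩` of a process, with its tag: `idx = k` if the entry was created by
the `k`-th write of that process, counting from zero. Tags are bookkeeping only; they influence
neither the actions available nor the values read. -/
structure Item (Var Val : Type*) where
  var : Var
  val : Val
  idx : ℕ

/-- A TSO state: main memory and one store buffer per process, oldest entry first. -/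
structure Store (n : ℕ) (Var Val : Type*) where
  mem : Var → Val
  buf : Fin n → List (Item Var Val)

/-- The local state of a process is the list of its records so far, oldest first. -/
abbrev LocalState (Var Val Lab Op Resp : Type*) := List (Record Var Val Lab Op Resp)

/-- A global state: a TSO state and a local state for every process. -/
structure GState (n : ℕ) (Var Val Lab Op Resp : Type*) where
  store : Store n Var Val
  loc : Fin n → LocalState Var Val Lab Op Resp

/-- Agents: processes and their local dispatchers. -/
inductive Agent (n : ℕ) where
  | proc (i : Fin n)
  | disp (i : Fin n)

/-- The process whose buffer an agent works on. -/
def Agent.owner {n : ℕ} : Agent n → Fin n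
  | .proc i => i
  | .disp i => i

/-- A joint action: an action (or null) for every process, `prop` or null for every dispatcher,
and at most one invocation for every process by the environment. -/
structure JointAction (n : ℕ) (Var Val Lab Op Resp : Type*) where
  act : Fin n → Option (Act Var Val Lab Resp)
  prop : Fin n → Bool
  inv : Fin n → Option Op

/-- Events, i.e. actions taking place. The argument `k` is the index part of the tag. -/
inductive Event (Var Val Lab Resp : Type*) where
  | write (x : Var) (v : Val) (k : ℕ)
  | rfb (x : Var) (v : Val) (k : ℕ)
  | rfm (x : Var) (v : Val)
  | fence
  | rmw (x : Var) (vexp vnew : Val)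
  | prop (x : Var) (v : Val) (k : ℕ)
  | internal (a : Lab)
  | ret (ρ : Resp)

namespace Event

variable {Var Val Lab Op Resp : Type*}

/-- The variable of which the event is a memory access, if any. -/
def access : Event Var Val Lab Resp → Option Var
  | rfm x _ => some x
  | rmw x _ _ => some x
  | prop x _ _ => some x
  | _ => none

def IsRfM : Event Var Val Lab Resp → Prop
  | rfm _ _ => True
  | _ => False

def IsProp : Event Var Val Lab Resp → Prop
  | prop _ _ _ => True
  | _ => False

/-- A fence or a read-modify-write. -/
def IsSync : Event Var Val Lab Resp → Prop
  | fence => True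
  | rmw _ _ _ => True
  | _ => False

/-- What a process records in its local state when the event takes place. -/
def record : Event Var Val Lab Resp → List (Record Var Val Lab Op Resp)
  | write x v _ => [.write x v]
  | rfb x v _ => [.read x v]
  | rfm x v => [.read x v]
  | fence => [.fence]
  | rmw x ve vn => [.rmw x ve vn]
  | prop _ _ _ => []
  | internal a => [.internal a]
  | ret ρ => [.ret ρ]

end Event

section Semantics

variable {n : ℕ} {Var Val Lab Op Resp : Type*} [DecidableEq Var]

/-- Number of writes recorded in a local state. -/
def numWrites (l : LocalState Var Val Lab Op Resp) : ℕ :=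
  l.countP fun e => match e with
    | .write _ _ => true
    | _ => false

/-- Whether an invoked operation has not yet returned, according to a local state. -/
def pending (l : LocalState Var Val Lab Op Resp) : Bool :=
  l.foldl (fun p e => match e with
    | .invoke _ => true
    | .ret _ => false
    | _ => p) false

/-- The newest entry for `x` in a buffer. -/
def newest (β : List (Item Var Val)) (x : Var) : Option (Item Var Val) :=
  (β.filter fun it => decide (it.var = x)).getLast?

/-- The event produced by a process performing an action in a global state. -/
def procEvent (g : GState n Var Val Lab Op Resp) (i : Fin n) :
    Act Var Val Lab Resp → Event Var Val Lab Resp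
  | .read x =>
      match newest (g.store.buf i) x with
      | some it => .rfb x it.val it.idx
      | none => .rfm x (g.store.mem x)
  | .write x v => .write x v (numWrites (g.loc i))
  | .fence => .fence
  | .rmw x ve vn => .rmw x ve vn
  | .internal a => .internal a
  | .ret ρ => .ret ρ

/-- The event, if any, that an agent produces when a joint action is performed. -/
def eventOf (g : GState n Var Val Lab Op Resp) (a : JointAction n Var Val Lab Op Resp) :
    Agent n → Option (Event Var Val Lab Resp)
  | .proc i => (a.act i).map (procEvent g i)
  | .disp i =>
      if a.prop i then (g.store.buf i).head?.map fun it => .prop it.var it.val it.idx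
      else none

/-- Preconditions of process actions. A return is the response to a pending operation. -/
def ActEnabled (g : GState n Var Val Lab Op Resp) (i : Fin n) : Act Var Val Lab Resp → Prop
  | .fence => g.store.buf i = []
  | .rmw x ve _ => g.store.buf i = [] ∧ g.store.mem x = ve
  | .ret _ => pending (g.loc i) = true
  | _ => True

/-- Two events of agents `b` and `c` conflict: both are memory accesses to the same variable, at
least one is not a read from memory, and they are not a propagation by `d_i` together with
a read from memory by `i`. -/
def Conflict (b c : Agent n) (e f : Event Var Val Lab Resp) : Prop :=
  (∃ x, e.access = some x ∧ f.access = some x) ∧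
  ¬ (e.IsRfM ∧ f.IsRfM) ∧
  ¬ (∃ i, (b = .disp i ∧ c = .proc i ∧ e.IsProp ∧ f.IsRfM) ∨
          (c = .disp i ∧ b = .proc i ∧ f.IsProp ∧ e.IsRfM))

/-- A joint action that can take place in a global state: all its actions are enabled there and
they do not conflict. The environment invokes an operation at a process only when no operation
is pending there. -/
structure Enabled (g : GState n Var Val Lab Op Resp)
    (a : JointAction n Var Val Lab Op Resp) : Prop where
  act : ∀ i α, a.act i = some α → ActEnabled g i α
  prop : ∀ i, a.prop i = true → g.store.buf i ≠ []
  inv : ∀ i o, a.inv i = some o → pending (g.loc i) = false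
  noConflict : ∀ b c e f, b ≠ c → eventOf g a b = some e → eventOf g a c = some f →
    ¬ Conflict b c e f

/-- The effect of a single event of an agent on the TSO state. -/
def effect (σ : Store n Var Val) (b : Agent n) :
    Event Var Val Lab Resp → Store n Var Val
  | .write x v k =>
      { σ with buf := Function.update σ.buf b.owner (σ.buf b.owner ++ [⟨x, v, k⟩]) }
  | .rmw x _ vn => { σ with mem := Function.update σ.mem x vn }
  | .prop x v _ =>
      { mem := Function.update σ.mem x v
        buf := Function.update σ.buf b.owner (σ.buf b.owner).tail }
  | _ => σ

/-- The order in which the components of a joint action are executed. -/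
def agents (n : ℕ) : List (Agent n) :=
  (List.finRange n).map Agent.proc ++ (List.finRange n).map Agent.disp

/-- The global state resulting from a joint action: the TSO state is obtained by executing the
components one by one, and the local states are extended by the new records. -/
def next (g : GState n Var Val Lab Op Resp) (a : JointAction n Var Val Lab Op Resp) :
    GState n Var Val Lab Op Resp where
  store := (agents n).foldl (fun σ b =>
    match eventOf g a b with
    | some e => effect σ b e
    | none => σ) g.store
  loc := fun i => g.loc i ++
    (match a.act i with
      | some α => (procEvent g i α).record
      | none => []) ++
    (match a.inv i with
      | some o => [.invoke o]
      | none => [])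

end Semantics

/-! ### Protocols and runs -/

/-- A (nondeterministic) protocol for `n` processes together with the initial contents of the
memory. -/
structure Protocol (n : ℕ) (Var Val Lab Op Resp : Type*) where
  step : Fin n → LocalState Var Val Lab Op Resp → Set (Option (Act Var Val Lab Resp))
  step_nonempty : ∀ i l, (step i l).Nonempty
  mem₀ : Var → Val

/-- A sequence of global states, with the joint actions performed in the successive rounds:
`joint t` is performed in `state t`. -/
structure Run (n : ℕ) (Var Val Lab Op Resp : Type*) where
  state : ℕ → GState n Var Val Lab Op Resp
  joint : ℕ → JointAction n Var Val Lab Op Resp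

/-- A node `⟨b, t⟩`: the point at time `t` on the timeline of agent `b`. -/
abbrev Node (n : ℕ) := Agent n × ℕ

section Runs

variable {n : ℕ} {Var Val Lab Op Resp : Type*} [DecidableEq Var]

/-- `r` is a TSO run of the protocol `P`. -/
structure Protocol.IsRun (P : Protocol n Var Val Lab Op Resp)
    (r : Run n Var Val Lab Op Resp) : Prop where
  mem_zero : (r.state 0).store.mem = P.mem₀
  buf_zero : ∀ i, (r.state 0).store.buf i = []
  loc_zero : ∀ i, (r.state 0).loc i = []
  enabled : ∀ t, Enabled (r.state t) (r.joint t)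
  state_succ : ∀ t, r.state (t + 1) = next (r.state t) (r.joint t)
  follows : ∀ t i α, (r.joint t).act i = some α → some α ∈ P.step i ((r.state t).loc i)

/-- The event at a node. -/
def Run.event (r : Run n Var Val Lab Op Resp) (θ : Node n) : Option (Event Var Val Lab Resp) :=
  eventOf (r.state θ.2) (r.joint θ.2) θ.1

/-- The TSO occurs-before relation between nodes of a run. -/
inductive Run.OB (r : Run n Var Val Lab Op Resp) : Node n → Node n → Prop
  | locality (b : Agent n) (t t' : ℕ) : t < t' → Run.OB r (b, t) (b, t')
  | write_prop (i : Fin n) (t t' : ℕ) (x x' : Var) (v v' : Val) (k : ℕ) : t < t' →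
      r.event (.proc i, t) = some (.write x v k) →
      r.event (.disp i, t') = some (.prop x' v' k) →
      Run.OB r (.proc i, t) (.disp i, t')
  | rfb_prop (i : Fin n) (t t' : ℕ) (x x' : Var) (v v' : Val) (k : ℕ) : t < t' →
      r.event (.proc i, t) = some (.rfb x v k) →
      r.event (.disp i, t') = some (.prop x' v' k) →
      Run.OB r (.proc i, t) (.disp i, t')
  | memory (b c : Agent n) (t t' : ℕ) (x : Var) (e f : Event Var Val Lab Resp) : t < t' →
      r.event (b, t) = some e → r.event (c, t') = some f →
      e.access = some x → f.access = some x →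
      ¬ (e.IsRfM ∧ f.IsRfM) →
      ¬ (∃ i, b = .disp i ∧ c = .proc i ∧ e.IsProp ∧ f.IsRfM) →
      Run.OB r (b, t) (c, t')
  | sync (i : Fin n) (t t' : ℕ) (e f : Event Var Val Lab Resp) : t < t' →
      r.event (.disp i, t) = some e → e.IsProp →
      r.event (.proc i, t') = some f → f.IsSync →
      Run.OB r (.disp i, t) (.proc i, t')
  | trans (θ₁ θ₂ θ₃ : Node n) : Run.OB r θ₁ θ₂ → Run.OB r θ₂ θ₃ → Run.OB r θ₁ θ₃

/-- No process reads an item from its buffer in the very round in which its dispatcher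
propagates that same item. -/
def Run.NoReadDuringProp (r : Run n Var Val Lab Op Resp) : Prop :=
  ∀ (i : Fin n) (t : ℕ) (x x' : Var) (v v' : Val) (k : ℕ),
    ¬ (r.event (.proc i, t) = some (.rfb x v k) ∧ r.event (.disp i, t) = some (.prop x' v' k))

end Runs

/-! ### Operations -/

/-- An operation of a run is identified by the process `proc` at which it is invoked and the time
`start` of its invocation, i.e. the invocation is part of the joint action performed at time
`start`; its initial node is `(.proc proc, start)`. -/
structure OpId (n : ℕ) where
  proc : Fin n
  start : ℕ

section Operations

variable {n : ℕ} {Var Val Lab Op Resp : Type*}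

/-- `X` is an invocation of the operation `o` in `r`. -/
def Run.IsOp (r : Run n Var Val Lab Op Resp) (X : OpId n) (o : Op) : Prop :=
  (r.joint X.start).inv X.proc = some o

/-- The operation `X` of `r` ends at time `e` with response `ρ`: the first return by its process
after the invocation takes place in round `e`, i.e. in the joint action performed at `e - 1`. -/
def Run.EndsWith (r : Run n Var Val Lab Op Resp) (X : OpId n) (e : ℕ) (ρ : Resp) : Prop :=
  (∃ o, r.IsOp X o) ∧
  ∃ u, e = u + 1 ∧ X.start < u ∧ (r.joint u).act X.proc = some (.ret ρ) ∧
    ∀ w ρ', X.start < w → w < u → (r.joint w).act X.proc ≠ some (.ret ρ')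

/-- `X` completes in `r`. -/
def Run.Completes (r : Run n Var Val Lab Op Resp) (X : OpId n) : Prop :=
  ∃ e ρ, r.EndsWith X e ρ

/-- Real-time order: the end of `X` is earlier than the start of `Y`. -/
def Run.Precedes (r : Run n Var Val Lab Op Resp) (X Y : OpId n) : Prop :=
  (∃ o, r.IsOp Y o) ∧ ∃ e ρ, r.EndsWith X e ρ ∧ e < Y.start

/-- Operation `X` occurs before operation `Y`: the initial node of `X` occurs before the final
node of `Y`. -/
def Run.OpOB [DecidableEq Var] (r : Run n Var Val Lab Op Resp) (X Y : OpId n) : Prop :=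
  (∃ o, r.IsOp X o) ∧
  ∃ e ρ, r.EndsWith Y e ρ ∧ r.OB (.proc X.proc, X.start) (.proc Y.proc, e)

/-! ### Linearizability -/

/-- An operation in a linearization, with its response. -/
structure LinEntry (n : ℕ) (Op Resp : Type*) where
  id : OpId n
  op : Op
  resp : Resp

/-- The history of `r` up to time `T` is linearizable with respect to a sequential
specification (a set of sequences of operations and responses): after adding responses to some
of the pending operations and removing the other pending operations, the operations can be
arranged in a sequence that belongs to the specification and that respects the order of the
operations of each process and the real-time order. -/
def Run.LinearizableUpTo (r : Run n Var Val Lab Op Resp)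
    (spec : Set (List (Fin n × Op × Resp))) (T : ℕ) : Prop :=
  ∃ L : List (LinEntry n Op Resp),
    (∀ a ∈ L, a.id.start < T ∧ r.IsOp a.id a.op) ∧
    (∀ a ∈ L, ∀ e ρ, r.EndsWith a.id e ρ → e ≤ T → a.resp = ρ) ∧
    (∀ X e ρ, r.EndsWith X e ρ → e ≤ T → ∃ a ∈ L, a.id = X) ∧
    (L.map LinEntry.id).Nodup ∧
    L.Pairwise (fun a b => a.id.proc = b.id.proc → a.id.start < b.id.start) ∧
    L.Pairwise (fun a b => ¬ r.Precedes b.id a.id) ∧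
    L.map (fun a => (a.id.proc, a.op, a.resp)) ∈ spec

end Operations

/-! ### The snapshot object -/

inductive SnapOp (W : Type*) where
  | update (w : W)
  | scan

/-- Responses; `none` in a view is the initial value of a component. -/
inductive SnapResp (n : ℕ) (W : Type*) where
  | ack
  | view (V : Fin n → Option W)

section Snapshot

variable {n : ℕ} {Var Val Lab W : Type*} [DecidableEq Var]

/-- The value written by the last update of process `k` in a sequential history. -/
def lastUpdate (h : List (Fin n × SnapOp W × SnapResp n W)) (k : Fin n) : Option W :=
  (h.filterMap fun e => match e with
    | (i, .update w, _) => if i = k then some w else none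
    | (_, .scan, _) => none).getLast?

/-- The sequential specification of the single-writer snapshot object. -/
def snapshotSpec (n : ℕ) (W : Type*) : Set (List (Fin n × SnapOp W × SnapResp n W)) :=
  {h | ∀ h₁ h₂ i o ρ, h = h₁ ++ (i, o, ρ) :: h₂ →
    match o with
    | .update _ => ρ = .ack
    | .scan => ρ = .view (lastUpdate h₁)}

/-- Standing convention on runs: a value is written at most once by a given process. -/
def Run.DistinctUpdates {Resp : Type*} (r : Run n Var Val Lab (SnapOp W) Resp) : Prop :=
  ∀ (X Y : OpId n) (w : W), X.proc = Y.proc → r.IsOp X (.update w) → r.IsOp Y (.update w) →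
    X.start = Y.start

/-- The protocol is a linearizable snapshot implementation. -/
def Protocol.IsLinearizableSnapshot
    (P : Protocol n Var Val Lab (SnapOp W) (SnapResp n W)) : Prop :=
  ∀ r, P.IsRun r → r.DistinctUpdates → ∀ T, r.LinearizableUpTo (snapshotSpec n W) T

end Snapshot

end TSO

/-! The proof is a delay argument. Suppose that the initial node of `X` does not occur before the
final node `θ` of `Y`. Perform in the first `θ.2 + 1` rounds only the actions in the past of `θ`, at
their old times, and afterwards all other actions, shifted by `θ.2 + 1`. The result `Run.delayed` is
again a run of the protocol (`Protocol.IsRun.delayed`). Each process goes through the same local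
history as in `r`, so responses are unchanged, but `X` is now invoked after `Y` has ended.

Both runs are linearizable, and `Run.scan_view` bounds a view from two sides: an entry is at least
as recent as every update preceding the scan, and does not come from an update that the scan
precedes. In (a), the scan shows in `r` the update `X` or a later one of the same process, but in
the delayed run all of these start after the scan has ended. In (b), the delayed scan shows `Y` or a
later update of the same process, but in `r` all of these start after the scan has ended. Since
values are distinct, a value identifies an update across both runs.

The past of `θ` meets every agent's timeline, and the stores to every variable, in an initial
segment (`Run.lt_cut_iff`, `Protocol.IsRun.lt_memCut_iff`). Hence a state of the delayed run is
described by cut times alone (`Run.Progress`). The delicate actions are the reads. A propagation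
need not occur before a later read from memory by the same process, so a process in the past may run
ahead of its dispatcher. Its read then finds in the buffer the value that it found in memory in `r`,
and local states do not record the difference (`Protocol.IsRun.read_of_past`). A read outside the
past keeps its source and value, since a past store that could change them would put the read into
the past (`Protocol.IsRun.read_of_rest`). -/

namespace TSO

/-! ### The effect of one joint action on buffers, memory and local states. -/

section StepLemmas

variable {n : ℕ} {Var Val Lab Op Resp : Type*}

/-- The variable and value that an event stores in main memory, if any. -/
def Event.memWrite : Event Var Val Lab Resp → Option (Var × Val)
  | .rmw x _ vn => some (x, vn)
  | .prop x v _ => some (x, v)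
  | _ => none

theorem Event.access_of_memWrite {e : Event Var Val Lab Resp} {x : Var} {v : Val}
    (h : e.memWrite = some (x, v)) : e.access = some x ∧ ¬ e.IsRfM := by
  cases e <;> simp_all [Event.memWrite, Event.access, Event.IsRfM]

/-- The entry that an event appends to a store buffer. -/
def Event.written : Event Var Val Lab Resp → List (Item Var Val)
  | .write x v k => [⟨x, v, k⟩]
  | _ => []

/-- All entries ever appended to the store buffer of a process, according to its local state. -/
def writtenItems (l : LocalState Var Val Lab Op Resp) : List (Item Var Val) :=
  l.foldl (fun acc e => match e with
    | .write x v => acc ++ [⟨x, v, acc.length⟩]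
    | _ => acc) []

theorem writtenItems_nil : writtenItems ([] : LocalState Var Val Lab Op Resp) = [] := rfl

theorem writtenItems_concat (l : LocalState Var Val Lab Op Resp) (e : Record Var Val Lab Op Resp) :
    writtenItems (l ++ [e]) = writtenItems l ++ (match e with
      | .write x v => [⟨x, v, (writtenItems l).length⟩]
      | _ => []) := by
  unfold writtenItems
  rw [List.foldl_append]
  cases e <;> simp

theorem length_writtenItems (l : LocalState Var Val Lab Op Resp) :
    (writtenItems l).length = numWrites l := by
  induction l using List.reverseRecOn with
  | nil => rfl
  | append_singleton l e ih =>
    rw [writtenItems_concat, List.length_append, ih]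
    unfold numWrites
    rw [List.countP_append]
    cases e <;> simp

/-- Tags are positions in the list of all writes, so matching tags in occurs-before amounts to
comparing positions with propagation counts. -/
theorem writtenItems_idx (l : LocalState Var Val Lab Op Resp) (k : ℕ) (it : Item Var Val)
    (h : (writtenItems l)[k]? = some it) : it.idx = k := by
  induction l using List.reverseRecOn with
  | nil => simp [writtenItems_nil] at h
  | append_singleton l e ih =>
    rw [writtenItems_concat] at h
    cases e
    case write x v =>
      simp only at h
      rcases lt_trichotomy k (writtenItems l).length with hk | hk | hk
      · rw [List.getElem?_append_left hk] at h
        exact ih h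
      · subst hk
        simp at h
        rw [← h]
      · rw [List.getElem?_eq_none (by simp; omega)] at h
        cases h
    all_goals
      simp only [List.append_nil] at h
      exact ih h

theorem writtenItems_prefix (l m : LocalState Var Val Lab Op Resp) :
    writtenItems l <+: writtenItems (l ++ m) := by
  induction m using List.reverseRecOn with
  | nil => simp
  | append_singleton m e ih =>
    rw [← List.append_assoc, writtenItems_concat]
    exact ih.trans (List.prefix_append _ _)

variable [DecidableEq Var]

theorem newest_append (β γ : List (Item Var Val)) (x : Var) :
    newest (β ++ γ) x = (newest γ x).or (newest β x) := by
  simp [newest, List.filter_append, List.getLast?_append]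

theorem newest_eq_none_iff (β : List (Item Var Val)) (x : Var) :
    newest β x = none ↔ ∀ it ∈ β, it.var ≠ x := by
  simp [newest]

theorem mem_of_newest_eq_some {β : List (Item Var Val)} {x : Var} {it : Item Var Val}
    (h : newest β x = some it) : it ∈ β ∧ it.var = x := by
  have := List.mem_of_getLast? h
  simpa using this

/-- Removing older entries does not change the newest entry, unless it is removed. -/
theorem newest_drop {l : List (Item Var Val)} {x : Var} {a b : ℕ} (hab : a ≤ b) :
    newest (l.drop b) x = none ∨ newest (l.drop b) x = newest (l.drop a) x := by
  have h : l.drop a = (l.drop a).take (b - a) ++ l.drop b := by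
    conv_lhs => rw [← List.take_append_drop (b - a) (l.drop a)]
    rw [List.drop_drop]
    congr 2
    omega
  rw [h, newest_append]
  cases newest (l.drop b) x <;> simp

/-- The records of a possibly absent event. -/
def recordsOf (e : Option (Event Var Val Lab Resp)) : LocalState Var Val Lab Op Resp :=
  match e with
  | some e => e.record
  | none => []

/-- The entry appended to the buffer by a possibly absent event. -/
def writtenOf (e : Option (Event Var Val Lab Resp)) : List (Item Var Val) :=
  match e with
  | some e => e.written
  | none => []

/-- The record of an invocation. -/
def invocation (o : Option Op) : LocalState Var Val Lab Op Resp :=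
  match o with
  | some o => [.invoke o]
  | none => []

theorem next_loc (g : GState n Var Val Lab Op Resp) (a : JointAction n Var Val Lab Op Resp)
    (i : Fin n) : (next g a).loc i =
      g.loc i ++ recordsOf (eventOf g a (.proc i)) ++ invocation (a.inv i) := by
  cases h : a.act i <;> simp only [next, eventOf, h, recordsOf, invocation] <;> rfl

theorem writtenItems_next (g : GState n Var Val Lab Op Resp)
    (a : JointAction n Var Val Lab Op Resp) (i : Fin n) :
    writtenItems ((next g a).loc i) =
      writtenItems (g.loc i) ++ writtenOf (eventOf g a (.proc i)) := by
  have hinv : ∀ l : LocalState Var Val Lab Op Resp,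
      writtenItems (l ++ invocation (a.inv i)) = writtenItems l := by
    intro l
    cases h : a.inv i
    · simp [invocation]
    · simp [invocation, writtenItems_concat]
  rw [next_loc, hinv]
  cases h : a.act i with
  | none => simp [eventOf, h, recordsOf, writtenOf]
  | some α =>
    cases α
    case read x =>
      cases h' : newest (g.store.buf i) x <;>
        simp [eventOf, h, h', recordsOf, writtenOf, procEvent, Event.record, Event.written,
          writtenItems_concat]
    all_goals
      simp only [eventOf, h, recordsOf, writtenOf, procEvent, Event.record, Event.written,
        Option.map_some, writtenItems_concat, length_writtenItems]

/-- The store after a single component of a joint action. -/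
def agentEffect (g : GState n Var Val Lab Op Resp) (a : JointAction n Var Val Lab Op Resp)
    (σ : Store n Var Val) (b : Agent n) : Store n Var Val :=
  match eventOf g a b with
  | some e => effect σ b e
  | none => σ

theorem next_store (g : GState n Var Val Lab Op Resp) (a : JointAction n Var Val Lab Op Resp) :
    (next g a).store = (agents n).foldl (agentEffect g a) g.store := rfl

theorem mem_agents (b : Agent n) : b ∈ agents n := by
  cases b <;> simp [agents]

theorem eventOf_disp_eq_some {g : GState n Var Val Lab Op Resp}
    {a : JointAction n Var Val Lab Op Resp} {i : Fin n} {e : Event Var Val Lab Resp}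
    (h : eventOf g a (.disp i) = some e) :
    a.prop i = true ∧ ∃ it, (g.store.buf i).head? = some it ∧ e = .prop it.var it.val it.idx := by
  unfold eventOf at h
  by_cases hp : a.prop i = true
  · simp only [hp, if_true, Option.map_eq_some_iff] at h
    obtain ⟨it, h1, h2⟩ := h
    exact ⟨hp, it, h1, h2.symm⟩
  · simp [hp] at h

theorem eventOf_proc_not_isProp {g : GState n Var Val Lab Op Resp}
    {a : JointAction n Var Val Lab Op Resp} {i : Fin n} {e : Event Var Val Lab Resp}
    (h : eventOf g a (.proc i) = some e) : ¬ e.IsProp := by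
  simp only [eventOf, Option.map_eq_some_iff] at h
  obtain ⟨α, -, rfl⟩ := h
  cases α
  case read x => cases h : newest (g.store.buf i) x <;> simp [procEvent, h, Event.IsProp]
  all_goals simp [procEvent, Event.IsProp]

theorem effect_mem_of_memWrite_ne {σ : Store n Var Val} {b : Agent n}
    {e : Event Var Val Lab Resp} {x : Var} (h : ∀ v, e.memWrite ≠ some (x, v)) :
    (effect σ b e).mem x = σ.mem x := by
  cases e <;> simp_all [effect, Event.memWrite, eq_comm]

theorem effect_mem_of_memWrite {σ : Store n Var Val} {b : Agent n}
    {e : Event Var Val Lab Resp} {x : Var} {v : Val} (h : e.memWrite = some (x, v)) :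
    (effect σ b e).mem x = v := by
  cases e <;> simp_all [effect, Event.memWrite]

theorem next_mem_of_forall_ne {g : GState n Var Val Lab Op Resp}
    {a : JointAction n Var Val Lab Op Resp} {x : Var}
    (h : ∀ b e v, eventOf g a b = some e → e.memWrite ≠ some (x, v)) :
    (next g a).store.mem x = g.store.mem x := by
  rw [next_store]
  suffices H : ∀ (l : List (Agent n)) (σ : Store n Var Val),
      (l.foldl (agentEffect g a) σ).mem x = σ.mem x from H _ _
  intro l
  induction l with
  | nil => intro σ; rfl
  | cons b l ih =>
    intro σ
    rw [List.foldl_cons, ih]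
    unfold agentEffect
    cases hb : eventOf g a b with
    | none => rfl
    | some e => exact effect_mem_of_memWrite_ne (fun v => h b e v hb)

theorem next_mem_of_forall_eq {g : GState n Var Val Lab Op Resp}
    {a : JointAction n Var Val Lab Op Resp} {x : Var} {v : Val} {b : Agent n}
    {e : Event Var Val Lab Resp} (hb : eventOf g a b = some e) (he : e.memWrite = some (x, v))
    (h : ∀ b e w, eventOf g a b = some e → e.memWrite = some (x, w) → w = v) :
    (next g a).store.mem x = v := by
  rw [next_store]
  -- Invariant of the fold: the storing agent is still to come, or `x` already holds `v`.
  have H : ∀ (l : List (Agent n)) (σ : Store n Var Val), b ∈ l ∨ σ.mem x = v →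
      (l.foldl (agentEffect g a) σ).mem x = v := by
    intro l
    induction l with
    | nil => intro σ hσ; simpa using hσ
    | cons c l ih =>
      intro σ hσ
      rw [List.foldl_cons]
      apply ih
      by_cases hw : ∃ e w, eventOf g a c = some e ∧ e.memWrite = some (x, w)
      · obtain ⟨e', w, h1, h2⟩ := hw
        right
        unfold agentEffect
        rw [h1]
        exact (effect_mem_of_memWrite h2).trans (h c e' w h1 h2)
      · rcases hσ with hσ | hσ
        · rcases List.mem_cons.1 hσ with rfl | hσ
          · exact absurd ⟨e, v, hb, he⟩ hw
          · exact Or.inl hσ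
        · right
          unfold agentEffect
          cases hc : eventOf g a c with
          | none => exact hσ
          | some e' =>
            rw [← hσ]
            exact effect_mem_of_memWrite_ne (fun w h2 => hw ⟨e', w, hc, h2⟩)
  exact H _ _ (Or.inl (mem_agents b))

theorem filter_agents_owner (i : Fin n) :
    (agents n).filter (fun b => decide (b.owner = i)) = [.proc i, .disp i] := by
  have h : (List.finRange n).filter (fun j => decide (j = i)) = [i] := by
    rw [List.filter_eq, List.count_eq_one_of_mem (List.nodup_finRange n) (List.mem_finRange i)]
    rfl
  have h1 : (fun b : Agent n => decide (b.owner = i)) ∘ Agent.proc = fun j => decide (j = i) := rfl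
  have h2 : (fun b : Agent n => decide (b.owner = i)) ∘ Agent.disp = fun j => decide (j = i) := rfl
  rw [agents, List.filter_append, List.filter_map, List.filter_map, h1, h2, h]
  rfl

/-- Only agents owned by `i` touch its buffer. Two stores that agree on this buffer are carried
along because the skipped agents change the rest of only one of them. -/
theorem foldl_agentEffect_buf (g : GState n Var Val Lab Op Resp)
    (a : JointAction n Var Val Lab Op Resp) (i : Fin n) (l : List (Agent n))
    (σ τ : Store n Var Val) (h : σ.buf i = τ.buf i) :
    (l.foldl (agentEffect g a) σ).buf i =
      ((l.filter fun b => decide (b.owner = i)).foldl (agentEffect g a) τ).buf i := by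
  induction l generalizing σ τ with
  | nil => simpa
  | cons b l ih =>
    rw [List.foldl_cons, List.filter_cons]
    by_cases hb : b.owner = i
    · simp only [hb, decide_true, if_true, List.foldl_cons]
      apply ih
      unfold agentEffect
      cases eventOf g a b with
      | none => exact h
      | some e => cases e <;> simp [effect, hb, h]
    · simp only [hb, decide_false]
      apply ih
      rw [← h]
      unfold agentEffect
      cases eventOf g a b with
      | none => rfl
      | some e => cases e <;> simp [effect, Function.update_of_ne (Ne.symm hb)]

theorem next_buf (g : GState n Var Val Lab Op Resp) (a : JointAction n Var Val Lab Op Resp)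
    (i : Fin n) : (next g a).store.buf i =
      if (eventOf g a (.disp i)).isSome then
        (g.store.buf i ++ writtenOf (eventOf g a (.proc i))).tail
      else g.store.buf i ++ writtenOf (eventOf g a (.proc i)) := by
  rw [next_store, foldl_agentEffect_buf g a i _ _ g.store rfl, filter_agents_owner]
  have h1 : (agentEffect g a g.store (.proc i)).buf i =
      g.store.buf i ++ writtenOf (eventOf g a (.proc i)) := by
    unfold agentEffect
    cases h : eventOf g a (.proc i) with
    | none => simp [writtenOf]
    | some e =>
      have := eventOf_proc_not_isProp h
      cases e <;> simp_all [effect, writtenOf, Event.written, Agent.owner, Event.IsProp]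
  rw [List.foldl_cons, List.foldl_cons, List.foldl_nil, ← h1]
  generalize agentEffect g a g.store (.proc i) = σ
  unfold agentEffect
  cases h : eventOf g a (.disp i) with
  | none => simp
  | some e =>
    obtain ⟨-, it, -, rfl⟩ := eventOf_disp_eq_some h
    simp [effect, Agent.owner]

/-- Two agents that store to the same variable in the same round coincide. -/
theorem Enabled.eq_of_memWrite {g : GState n Var Val Lab Op Resp}
    {a : JointAction n Var Val Lab Op Resp} (ha : Enabled g a) {b c : Agent n}
    {e f : Event Var Val Lab Resp} {x : Var} {v w : Val} (hb : eventOf g a b = some e)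
    (hc : eventOf g a c = some f) (he : e.memWrite = some (x, v))
    (hf : f.memWrite = some (x, w)) : b = c := by
  by_contra hbc
  refine ha.noConflict b c e f hbc hb hc ⟨⟨x, ?_, ?_⟩, ?_, ?_⟩
  · cases e <;> simp_all [Event.memWrite, Event.access]
  · cases f <;> simp_all [Event.memWrite, Event.access]
  · cases e <;> simp_all [Event.memWrite, Event.IsRfM]
  · cases e <;> cases f <;> simp_all [Event.memWrite, Event.IsRfM]

theorem next_mem_of_memWrite {g : GState n Var Val Lab Op Resp}
    {a : JointAction n Var Val Lab Op Resp} (ha : Enabled g a) {x : Var} {v : Val} {b : Agent n}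
    {e : Event Var Val Lab Resp} (hb : eventOf g a b = some e) (he : e.memWrite = some (x, v)) :
    (next g a).store.mem x = v := by
  refine next_mem_of_forall_eq hb he fun c f w hc hf => ?_
  have := ha.eq_of_memWrite hb hc he hf
  subst this
  rw [hb] at hc
  cases hc
  rw [he] at hf
  cases hf
  rfl

end StepLemmas

/-! ### Buffers and memory along a run, and the past of a node. -/

section RunLemmas

variable {n : ℕ} {Var Val Lab Op Resp : Type*} [DecidableEq Var]

/-- If the buffer consists of all items of a list but the first `c`, then this remains true, with
updated list and count, after a joint action. -/
theorem next_buf_eq_drop {g : GState n Var Val Lab Op Resp}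
    {a : JointAction n Var Val Lab Op Resp} {i : Fin n} {c : ℕ} {l : List (Item Var Val)}
    (h : g.store.buf i = l.drop c) (hc : c ≤ l.length) :
    (next g a).store.buf i = (l ++ writtenOf (eventOf g a (.proc i))).drop
      (c + if (eventOf g a (.disp i)).isSome then 1 else 0) ∧
    (c + if (eventOf g a (.disp i)).isSome then 1 else 0) ≤
      (l ++ writtenOf (eventOf g a (.proc i))).length := by
  rw [next_buf, h, ← List.drop_append_of_le_length hc]
  by_cases hd : (eventOf g a (.disp i)).isSome
  · simp only [hd, if_true, List.tail_drop, true_and]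
    obtain ⟨e, he⟩ := Option.isSome_iff_exists.1 hd
    obtain ⟨-, it, h1, -⟩ := eventOf_disp_eq_some he
    rw [h, List.head?_drop] at h1
    have := (List.getElem?_eq_some_iff.1 h1).1
    rw [List.length_append]
    omega
  · simp only [hd]
    simp
    omega

/-- The number of propagations by the dispatcher of `i` before time `t`. -/
def Run.propCount (r : Run n Var Val Lab Op Resp) (i : Fin n) : ℕ → ℕ
  | 0 => 0
  | t + 1 => r.propCount i t + if (r.event (.disp i, t)).isSome then 1 else 0

/-- The entries appended to the buffer of `i` before time `t`. -/
def Run.items (r : Run n Var Val Lab Op Resp) (i : Fin n) (t : ℕ) : List (Item Var Val) :=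
  writtenItems ((r.state t).loc i)

theorem Run.propCount_mono (r : Run n Var Val Lab Op Resp) (i : Fin n) :
    Monotone (r.propCount i) :=
  monotone_nat_of_le_succ fun _ => Nat.le_add_right _ _

/-- Every item propagated within an interval is propagated at some time in it. -/
theorem Run.exists_prop (r : Run n Var Val Lab Op Resp) {i : Fin n} {a b k : ℕ}
    (h1 : r.propCount i a ≤ k) (h2 : k < r.propCount i b) :
    ∃ t, a ≤ t ∧ t < b ∧ r.propCount i t = k ∧ ∃ e, r.event (.disp i, t) = some e := by
  induction b with
  | zero => simp [Run.propCount] at h2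
  | succ b ih =>
    by_cases hb : k < r.propCount i b
    · obtain ⟨t, ht⟩ := ih hb
      exact ⟨t, ht.1, by omega, ht.2.2⟩
    · have hab : a ≤ b := by
        by_contra hab
        have := r.propCount_mono i (show b + 1 ≤ a by omega)
        omega
      rw [Run.propCount] at h2
      by_cases hs : (r.event (.disp i, b)).isSome
      · simp only [hs, if_true] at h2
        exact ⟨b, hab, by omega, by omega, Option.isSome_iff_exists.1 hs⟩
      · simp only [hs] at h2
        simp at h2
        omega

variable {P : Protocol n Var Val Lab Op Resp} {r : Run n Var Val Lab Op Resp}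

theorem Protocol.IsRun.loc_prefix (hr : P.IsRun r) (i : Fin n) {s t : ℕ} (h : s ≤ t) :
    (r.state s).loc i <+: (r.state t).loc i := by
  induction t, h using Nat.le_induction with
  | base => exact List.prefix_rfl
  | succ t _ ih =>
    rw [hr.state_succ, next_loc, List.append_assoc]
    exact ih.trans (List.prefix_append _ _)

theorem Protocol.IsRun.items_prefix (hr : P.IsRun r) (i : Fin n) {s t : ℕ} (h : s ≤ t) :
    r.items i s <+: r.items i t := by
  obtain ⟨m, hm⟩ := hr.loc_prefix i h
  rw [Run.items, Run.items, ← hm]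
  exact writtenItems_prefix _ _

theorem Protocol.IsRun.items_getElem? (hr : P.IsRun r) (i : Fin n) {s t k : ℕ} (h : s ≤ t)
    (hk : k < (r.items i s).length) : (r.items i t)[k]? = (r.items i s)[k]? := by
  obtain ⟨m, hm⟩ := hr.items_prefix i h
  rw [← hm, List.getElem?_append_left hk]

theorem Protocol.IsRun.items_succ (hr : P.IsRun r) (i : Fin n) (t : ℕ) :
    r.items i (t + 1) = r.items i t ++ writtenOf (r.event (.proc i, t)) := by
  rw [Run.items, hr.state_succ, writtenItems_next]
  rfl

/-- A buffer is determined by the list of writes and a count of propagations. This description still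
makes sense when process and dispatcher have advanced to different times of `r`, as they do in the
delayed run. -/
theorem Protocol.IsRun.buf_eq (hr : P.IsRun r) (i : Fin n) (t : ℕ) :
    (r.state t).store.buf i = (r.items i t).drop (r.propCount i t) ∧
      r.propCount i t ≤ (r.items i t).length := by
  induction t with
  | zero => simp [hr.buf_zero, Run.items, hr.loc_zero, writtenItems_nil, Run.propCount]
  | succ t ih =>
    rw [hr.items_succ, Run.propCount, hr.state_succ]
    exact next_buf_eq_drop ih.1 ih.2

theorem Protocol.IsRun.event_disp (hr : P.IsRun r) {i : Fin n} {t : ℕ}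
    {e : Event Var Val Lab Resp} (h : r.event (.disp i, t) = some e) :
    ∃ it, (r.items i t)[r.propCount i t]? = some it ∧
      e = .prop it.var it.val (r.propCount i t) := by
  obtain ⟨-, it, h1, h2⟩ := eventOf_disp_eq_some h
  simp only [(hr.buf_eq i t).1, List.head?_drop] at h1
  have := writtenItems_idx _ _ _ h1
  exact ⟨it, h1, by rw [← this]; exact h2⟩

theorem Protocol.IsRun.exists_write (hr : P.IsRun r) {i : Fin n} {t k : ℕ} {it : Item Var Val}
    (h : (r.items i t)[k]? = some it) :
    ∃ t' < t, r.event (.proc i, t') = some (.write it.var it.val k) ∧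
      k < (r.items i (t' + 1)).length := by
  induction t with
  | zero => simp [Run.items, hr.loc_zero, writtenItems_nil] at h
  | succ t ih =>
    by_cases hk : k < (r.items i t).length
    · obtain ⟨t', h1, h2⟩ := ih (by
        rw [hr.items_succ, List.getElem?_append_left hk] at h
        exact h)
      exact ⟨t', by omega, h2⟩
    · have hidx := writtenItems_idx _ _ _ h
      have hlen := (List.getElem?_eq_some_iff.1 h).1
      rw [hr.items_succ, List.getElem?_append_right (by omega)] at h
      refine ⟨t, by omega, ?_, hlen⟩
      have hmem := List.mem_of_getElem? h
      cases he : r.event (.proc i, t) with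
      | none => simp [he, writtenOf] at hmem
      | some e =>
        cases e <;> simp [he, writtenOf, Event.written] at hmem
        subst hmem
        subst hidx
        rfl

theorem Protocol.IsRun.mem_eq_of_forall_ne (hr : P.IsRun r) {x : Var} {s t : ℕ} (hst : s ≤ t)
    (h : ∀ u, s ≤ u → u < t → ∀ b e v, r.event (b, u) = some e → e.memWrite ≠ some (x, v)) :
    (r.state t).store.mem x = (r.state s).store.mem x := by
  induction t, hst using Nat.le_induction with
  | base => rfl
  | succ t hst ih =>
    rw [hr.state_succ,
      next_mem_of_forall_ne (g := r.state t) (a := r.joint t) (x := x) (h t hst (Nat.lt_succ_self t))]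
    exact ih fun u h1 h2 => h u h1 (by omega)

theorem Protocol.IsRun.mem_succ (hr : P.IsRun r) {b : Agent n} {t : ℕ}
    {e : Event Var Val Lab Resp} {x : Var} {v : Val} (hb : r.event (b, t) = some e)
    (he : e.memWrite = some (x, v)) : (r.state (t + 1)).store.mem x = v := by
  rw [hr.state_succ]
  exact next_mem_of_memWrite (hr.enabled t) hb he

/-! ### The past of a node -/

theorem Run.OB.lt {θ θ' : Node n} (h : r.OB θ θ') : θ.2 < θ'.2 := by
  induction h with
  | trans _ _ _ _ _ h1 h2 => exact h1.trans h2
  | _ => assumption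

/-- The time up to which the nodes of `b` occur before `θ`. -/
noncomputable def Run.cut (r : Run n Var Val Lab Op Resp) (θ : Node n) (b : Agent n) : ℕ :=
  sInf {t | ¬ r.OB (b, t) θ}

theorem Run.not_OB_self (θ : Node n) (b : Agent n) : ¬ r.OB (b, θ.2) θ :=
  fun h => lt_irrefl _ h.lt

theorem Run.cut_le (θ : Node n) (b : Agent n) : r.cut θ b ≤ θ.2 :=
  Nat.sInf_le (Run.not_OB_self θ b)

/-- Locality and transitivity make the past of `θ` downward closed on each timeline. -/
theorem Run.lt_cut_iff {θ : Node n} {b : Agent n} {t : ℕ} :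
    t < r.cut θ b ↔ r.OB (b, t) θ := by
  constructor
  · intro h
    by_contra hn
    exact Nat.notMem_of_lt_sInf h hn
  · intro h
    by_contra hn
    have hm : ¬ r.OB (b, r.cut θ b) θ := Nat.sInf_mem (s := {t | ¬ r.OB (b, t) θ})
      ⟨θ.2, Run.not_OB_self θ b⟩
    rcases (not_lt.1 hn).eq_or_lt with h' | h'
    · exact hm (h' ▸ h)
    · exact hm (.trans _ _ _ (.locality b _ _ h') h)

/-- The time up to which the stores to `x` occur before `θ`. -/
noncomputable def Run.memCut (r : Run n Var Val Lab Op Resp) (θ : Node n) (x : Var) : ℕ :=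
  sInf {t | ∀ u, t ≤ u → ∀ b e v, r.event (b, u) = some e → e.memWrite = some (x, v) →
    ¬ r.OB (b, u) θ}

theorem Run.time_mem_memCut (θ : Node n) (x : Var) : ∀ u, θ.2 ≤ u → ∀ b e v,
    r.event (b, u) = some e → e.memWrite = some (x, v) → ¬ r.OB (b, u) θ :=
  fun _ hu _ _ _ _ _ h => absurd h.lt (not_lt.2 hu)

theorem Run.memCut_le (θ : Node n) (x : Var) : r.memCut θ x ≤ θ.2 :=
  Nat.sInf_le (Run.time_mem_memCut θ x)

theorem Run.OB.of_memWrite {b c : Agent n} {t t' : ℕ} {e f : Event Var Val Lab Resp} {x : Var}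
    {v w : Val} (htt : t < t') (hb : r.event (b, t) = some e) (hc : r.event (c, t') = some f)
    (he : e.memWrite = some (x, v)) (hf : f.memWrite = some (x, w)) : r.OB (b, t) (c, t') :=
  .memory b c t t' x e f htt hb hc (Event.access_of_memWrite he).1 (Event.access_of_memWrite hf).1
    (fun h => (Event.access_of_memWrite he).2 h.1)
    (fun ⟨_, _, _, _, h⟩ => (Event.access_of_memWrite hf).2 h)

/-- Stores to one variable are linearly ordered by occurs-before: two in the same round would
conflict, and in different rounds the memory clause applies. So those in the past form an initial
segment. -/
theorem Protocol.IsRun.lt_memCut_iff (hr : P.IsRun r) {θ : Node n} {b : Agent n} {t : ℕ}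
    {e : Event Var Val Lab Resp} {x : Var} {v : Val} (hb : r.event (b, t) = some e)
    (he : e.memWrite = some (x, v)) : t < r.memCut θ x ↔ r.OB (b, t) θ := by
  constructor
  · intro h
    have hn := Nat.notMem_of_lt_sInf h
    simp only [Set.mem_ofPred_eq, not_forall, not_not] at hn
    obtain ⟨u, htu, c, f, w, hc, hf, hob⟩ := hn
    rcases htu.eq_or_lt with rfl | htu
    · have hbc : b = c := (hr.enabled t).eq_of_memWrite hb hc he hf
      rwa [hbc]
    · exact .trans _ _ _ (.of_memWrite htu hb hc he hf) hob
  · intro h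
    by_contra hn
    exact Nat.sInf_mem (s := {t | ∀ u, t ≤ u → ∀ b e v, r.event (b, u) = some e →
      e.memWrite = some (x, v) → ¬ r.OB (b, u) θ}) ⟨θ.2, Run.time_mem_memCut θ x⟩
      t (not_lt.1 hn) b e v hb he h

end RunLemmas

/-! ### Performing part of a joint action in another state. -/

section Replay

variable {n : ℕ} {Var Val Lab Op Resp : Type*} [DecidableEq Var]

/-- `e'` equals `e`, or it reads from the buffer the value that `e` reads from memory. -/
def Event.Matches (e' e : Event Var Val Lab Resp) : Prop :=
  e' = e ∨ ∃ x v k, e' = .rfb x v k ∧ e = .rfm x v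

omit [DecidableEq Var] in
theorem Event.Matches.eq_of_access {e' e : Event Var Val Lab Resp} (h : e'.Matches e) {x : Var}
    (hx : e'.access = some x) : e' = e := by
  rcases h with h | ⟨y, v, k, rfl, -⟩
  · exact h
  · cases hx

open Classical in
/-- The part of a joint action that consists of the actions of the agents in `A` and of the
invocations at the processes in `A`. -/
noncomputable def JointAction.restrict (a : JointAction n Var Val Lab Op Resp)
    (A : Agent n → Prop) : JointAction n Var Val Lab Op Resp where
  act i := if A (.proc i) then a.act i else none
  prop i := if A (.disp i) then a.prop i else false
  inv i := if A (.proc i) then a.inv i else none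

/-- In state `g'` the agents in `A` can perform their part of `a` with the same outcome as
in `g`. -/
structure Imitates (A : Agent n → Prop) (a : JointAction n Var Val Lab Op Resp)
    (g g' : GState n Var Val Lab Op Resp) : Prop where
  loc : ∀ i, A (.proc i) → g'.loc i = g.loc i
  enabled : ∀ i α, A (.proc i) → a.act i = some α → ActEnabled g' i α
  matches_event : ∀ i α, A (.proc i) → a.act i = some α →
    (procEvent g' i α).Matches (procEvent g i α)
  head : ∀ i, A (.disp i) → a.prop i = true →
    (g'.store.buf i).head? = (g.store.buf i).head?

variable {A : Agent n → Prop} {a : JointAction n Var Val Lab Op Resp}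
  {g g' : GState n Var Val Lab Op Resp}

theorem eventOf_restrict_of_not {b : Agent n} (hb : ¬ A b) :
    eventOf g' (a.restrict A) b = none := by
  cases b <;> simp [eventOf, JointAction.restrict, hb]

theorem Imitates.eventOf_disp (h : Imitates A a g g') {i : Fin n} (hi : A (.disp i)) :
    eventOf g' (a.restrict A) (.disp i) = eventOf g a (.disp i) := by
  by_cases hp : a.prop i = true
  · simp [eventOf, JointAction.restrict, hi, hp, h.head i hi hp]
  · simp [eventOf, JointAction.restrict, hp]

theorem Imitates.eventOf_cases (h : Imitates A a g g') {b : Agent n} (hb : A b) :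
    (eventOf g' (a.restrict A) b = none ∧ eventOf g a b = none) ∨
    ∃ e' e : Event Var Val Lab Resp, eventOf g' (a.restrict A) b = some e' ∧
      eventOf g a b = some e ∧ e'.Matches e := by
  cases b with
  | disp i =>
    rw [h.eventOf_disp hb]
    cases eventOf g a (.disp i) with
    | none => simp
    | some e => exact Or.inr ⟨e, e, rfl, rfl, Or.inl rfl⟩
  | proc i =>
    cases hα : a.act i with
    | none => simp [eventOf, JointAction.restrict, hα]
    | some α =>
      refine Or.inr ⟨procEvent g' i α, procEvent g i α, ?_, ?_, h.matches_event i α hb hα⟩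
      · simp [eventOf, JointAction.restrict, hb, hα]
      · simp [eventOf, hα]

theorem Imitates.eventOf_eq_some (h : Imitates A a g g') {b : Agent n}
    {e' : Event Var Val Lab Resp} (he : eventOf g' (a.restrict A) b = some e') :
    A b ∧ ∃ e, eventOf g a b = some e ∧ e'.Matches e := by
  have hb : A b := by
    by_contra hb
    rw [eventOf_restrict_of_not hb] at he
    cases he
  refine ⟨hb, ?_⟩
  rcases h.eventOf_cases hb with h' | ⟨f', f, h1, h2, h3⟩
  · rw [h'.1] at he
    cases he
  · rw [h1] at he
    cases he
    exact ⟨f, h2, h3⟩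

/-- Dropping actions creates no conflict, and a read that moves from memory to the buffer ceases to
be a memory access. -/
theorem Imitates.enabled_restrict (h : Imitates A a g g') (ha : Enabled g a) :
    Enabled g' (a.restrict A) where
  act i α hα := by
    by_cases hA : A (.proc i)
    · simp only [JointAction.restrict, hA, if_true] at hα
      exact h.enabled i α hA hα
    · simp [JointAction.restrict, hA] at hα
  prop i hp := by
    by_cases hA : A (.disp i)
    · simp only [JointAction.restrict, hA, if_true] at hp
      have h1 := ha.prop i hp
      have h2 := h.head i hA hp
      rw [ne_eq, ← List.head?_eq_none_iff] at h1 ⊢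
      rwa [h2]
    · simp [JointAction.restrict, hA] at hp
  inv i o ho := by
    by_cases hA : A (.proc i)
    · simp only [JointAction.restrict, hA, if_true] at ho
      rw [h.loc i hA]
      exact ha.inv i o ho
    · simp [JointAction.restrict, hA] at ho
  noConflict b c e' f' hbc hb hc hconf := by
    obtain ⟨-, e, he, hme⟩ := h.eventOf_eq_some hb
    obtain ⟨-, f, hf, hmf⟩ := h.eventOf_eq_some hc
    obtain ⟨⟨x, hx, hy⟩, -⟩ := id hconf
    rw [hme.eq_of_access hx, hmf.eq_of_access hy] at hconf
    exact ha.noConflict b c e f hbc he hf hconf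

/-- This rests on the convention that a read is recorded in the same way whether it comes from the
buffer or from memory. -/
theorem Imitates.next_loc (h : Imitates A a g g') {i : Fin n} (hi : A (.proc i)) :
    (next g' (a.restrict A)).loc i = (next g a).loc i := by
  have hinv : (a.restrict A).inv i = a.inv i := by simp [JointAction.restrict, hi]
  rw [TSO.next_loc, TSO.next_loc, h.loc i hi, hinv]
  congr 2
  rcases h.eventOf_cases hi with h' | ⟨e', e, h1, h2, h3⟩
  · rw [h'.1, h'.2]
  · rw [h1, h2]
    rcases h3 with rfl | ⟨x, v, k, rfl, rfl⟩ <;> rfl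

theorem next_loc_restrict_of_not {i : Fin n} (hi : ¬ A (.proc i)) :
    (next g' (a.restrict A)).loc i = g'.loc i := by
  have hinv : (a.restrict A).inv i = none := by simp [JointAction.restrict, hi]
  rw [TSO.next_loc, eventOf_restrict_of_not hi, hinv]
  simp [recordsOf, invocation]

theorem Imitates.writtenOf_eq (h : Imitates A a g g') {i : Fin n} (hi : A (.proc i)) :
    writtenOf (eventOf g' (a.restrict A) (.proc i)) = writtenOf (eventOf g a (.proc i)) := by
  rcases h.eventOf_cases hi with h' | ⟨e', e, h1, h2, h3⟩
  · rw [h'.1, h'.2]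
  · rw [h1, h2]
    rcases h3 with rfl | ⟨x, v, k, rfl, rfl⟩ <;> rfl

/-- If `A` contains all agents that store to `x`, then the effect on `x` is the full one. -/
theorem Imitates.next_mem (h : Imitates A a g g') (ha : Enabled g a) {x : Var}
    (hmem : g'.store.mem x = g.store.mem x)
    (hA : ∀ b e v, eventOf g a b = some e → e.memWrite = some (x, v) → A b) :
    (next g' (a.restrict A)).store.mem x = (next g a).store.mem x := by
  by_cases hw : ∃ b e v, eventOf g a b = some e ∧ e.memWrite = some (x, v)
  · obtain ⟨b, e, v, hb, he⟩ := hw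
    rw [next_mem_of_memWrite ha hb he]
    rcases h.eventOf_cases (hA b e v hb he) with h' | ⟨e', f, h1, h2, h3⟩
    · rw [h'.2] at hb
      cases hb
    · rw [h2] at hb
      cases hb
      rcases h3 with rfl | ⟨x, v, k, rfl, rfl⟩
      · exact next_mem_of_memWrite (h.enabled_restrict ha) h1 he
      · cases he
  · rw [next_mem_of_forall_ne (g := g) (fun b e v hb he => hw ⟨b, e, v, hb, he⟩),
      next_mem_of_forall_ne, hmem]
    intro b e' v hb he
    obtain ⟨-, e, h1, h2⟩ := h.eventOf_eq_some hb
    rw [h2.eq_of_access (Event.access_of_memWrite he).1] at he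
    exact hw ⟨b, e, v, h1, he⟩

/-- If `A` contains no agent that stores to `x`, then `x` does not change. -/
theorem Imitates.next_mem_of_not (h : Imitates A a g g') {x : Var}
    (hA : ∀ b e v, eventOf g a b = some e → e.memWrite = some (x, v) → ¬ A b) :
    (next g' (a.restrict A)).store.mem x = g'.store.mem x := by
  refine next_mem_of_forall_ne fun b e' v hb he => ?_
  obtain ⟨hAb, e, h1, h2⟩ := h.eventOf_eq_some hb
  rw [h2.eq_of_access (Event.access_of_memWrite he).1] at he
  exact hA b e v h1 he hAb

/-! ### Partial progress -/

/-- In the state `g'` every agent `b` has performed the actions of `r` before the time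
`f (r.cut θ b)`, and the stores to `x` before the time `f (r.memCut θ x)` have taken place. -/
structure Run.Progress (r : Run n Var Val Lab Op Resp) (θ : Node n) (f : ℕ → ℕ)
    (g' : GState n Var Val Lab Op Resp) : Prop where
  loc : ∀ i, g'.loc i = (r.state (f (r.cut θ (.proc i)))).loc i
  buf : ∀ i, g'.store.buf i =
    (r.items i (f (r.cut θ (.proc i)))).drop (r.propCount i (f (r.cut θ (.disp i))))
  le : ∀ i, r.propCount i (f (r.cut θ (.disp i))) ≤ (r.items i (f (r.cut θ (.proc i)))).length
  mem : ∀ x, g'.store.mem x = (r.state (f (r.memCut θ x))).store.mem x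

variable {P : Protocol n Var Val Lab Op Resp} {r : Run n Var Val Lab Op Resp} {θ : Node n}

theorem Protocol.IsRun.event_of_prop (hr : P.IsRun r) {i : Fin n} {t : ℕ}
    (hp : (r.joint t).prop i = true) : ∃ e, r.event (.disp i, t) = some e := by
  have := (hr.enabled t).prop i hp
  rw [ne_eq, ← List.head?_eq_none_iff] at this
  obtain ⟨it, hit⟩ := Option.ne_none_iff_exists'.1 this
  exact ⟨_, by simp only [Run.event, eventOf, hp, if_true, hit]; rfl⟩

theorem Run.event_proc {i : Fin n} {t : ℕ} {α : Act Var Val Lab Resp}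
    (h : (r.joint t).act i = some α) :
    r.event (.proc i, t) = some (procEvent (r.state t) i α) := by
  simp [Run.event, eventOf, h]

/-- While the past of `θ` is performed, a dispatcher in it finds the item that it propagates
in `r`. -/
theorem Protocol.IsRun.head_of_past (hr : P.IsRun r) {t : ℕ}
    (h : r.Progress θ (min t) g') {i : Fin n} (hi : t < r.cut θ (.disp i))
    (hp : (r.joint t).prop i = true) :
    (g'.store.buf i).head? = ((r.state t).store.buf i).head? := by
  obtain ⟨e, he⟩ := hr.event_of_prop hp
  obtain ⟨it, hit, rfl⟩ := hr.event_disp he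
  rw [h.buf, (hr.buf_eq i t).1, List.head?_drop, List.head?_drop, min_eq_left hi.le]
  obtain ⟨t', ht', hw, hlen⟩ := hr.exists_write hit
  -- The write of an item occurs before its propagation, hence lies in the past and has already been
  -- replayed.
  have hcut : t' < r.cut θ (.proc i) := Run.lt_cut_iff.2
    (.trans _ _ _ (.write_prop i t' t _ _ _ _ _ ht' hw he) (Run.lt_cut_iff.1 hi))
  have hlt := hlen.trans_le
    (hr.items_prefix i (show t' + 1 ≤ min t (r.cut θ (.proc i)) by omega)).length_le
  exact (hr.items_getElem? i (min_le_left _ _) hlt).symm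

end Replay

/-! ### Actions inside and outside the past have the same outcome in the delayed run. -/

section Imitation

variable {n : ℕ} {Var Val Lab Op Resp : Type*} [DecidableEq Var]
  {g' : GState n Var Val Lab Op Resp}
  {P : Protocol n Var Val Lab Op Resp} {r : Run n Var Val Lab Op Resp} {θ : Node n}

omit [DecidableEq Var] in
theorem mem_drop_of_getElem? {l : List (Item Var Val)} {c k : ℕ} {it : Item Var Val}
    (h : l[k]? = some it) (hc : c ≤ k) : it ∈ l.drop c := by
  apply List.mem_of_getElem? (i := k - c)
  rw [List.getElem?_drop, Nat.add_sub_cancel' hc, h]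

omit [DecidableEq Var] in
theorem exists_getElem?_of_mem_drop {l : List (Item Var Val)} {c : ℕ} {it : Item Var Val}
    (h : it ∈ l.drop c) : ∃ k, c ≤ k ∧ l[k]? = some it := by
  obtain ⟨k, hk⟩ := List.mem_iff_getElem?.1 h
  exact ⟨c + k, Nat.le_add_right _ _, by rwa [List.getElem?_drop] at hk⟩

omit [DecidableEq Var] in
theorem Run.items_idx {i : Fin n} {t k : ℕ} {it : Item Var Val}
    (h : (r.items i t)[k]? = some it) : it.idx = k :=
  writtenItems_idx _ _ _ h

/-- An item propagated at time `u` is stored in memory, and it is among the items written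
before any later time. -/
theorem Protocol.IsRun.event_disp_of_le (hr : P.IsRun r) {i : Fin n} {u t : ℕ} (hut : u ≤ t)
    {e : Event Var Val Lab Resp} (h : r.event (.disp i, u) = some e) :
    ∃ it, (r.items i t)[r.propCount i u]? = some it ∧ e.memWrite = some (it.var, it.val) := by
  obtain ⟨it, h1, rfl⟩ := hr.event_disp h
  refine ⟨it, ?_, rfl⟩
  rw [hr.items_getElem? i hut (List.getElem?_eq_some_iff.1 h1).1, h1]

theorem Run.OB.of_memWrite_of_rfm {b : Agent n} {i : Fin n} {u t : ℕ}
    {e : Event Var Val Lab Resp} {x : Var} {v w : Val} (hut : u < t)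
    (hb : r.event (b, u) = some e) (he : e.memWrite = some (x, v))
    (hi : r.event (.proc i, t) = some (.rfm x w)) (hne : b ≠ .disp i) :
    r.OB (b, u) (.proc i, t) := by
  refine .memory b _ u t x e _ hut hb hi (Event.access_of_memWrite he).1 rfl
    (fun h => (Event.access_of_memWrite he).2 h.1) ?_
  rintro ⟨j, h1, h2, -⟩
  cases h2
  exact hne h1

/-- The own dispatcher may lag behind, so the buffer may contain extra old entries. They do not
affect a read from the buffer. For a read from memory, every earlier store to `x` by another agent
is in the past, so only own propagations can be missing. -/
theorem Protocol.IsRun.read_of_past (hr : P.IsRun r) {t : ℕ} (h : r.Progress θ (min t) g')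
    {i : Fin n} (hi : t < r.cut θ (.proc i)) {x : Var} (hα : (r.joint t).act i = some (.read x)) :
    (procEvent g' i (.read x)).Matches (procEvent (r.state t) i (.read x)) := by
  have hev := Run.event_proc hα
  have hbuf' := h.buf i
  rw [min_eq_left hi.le] at hbuf'
  have hbuf := (hr.buf_eq i t).1
  have hq : ∀ u, u < t → ¬ r.OB (.disp i, u) θ → min t (r.cut θ (.disp i)) ≤ u := by
    intro u hu hn
    rw [← Run.lt_cut_iff] at hn
    omega
  set c' := r.propCount i (min t (r.cut θ (.disp i)))
  have hc : c' ≤ r.propCount i t := r.propCount_mono i (min_le_left _ _)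
  simp only [procEvent, hbuf, hbuf'] at hev ⊢
  cases hn : newest ((r.items i t).drop (r.propCount i t)) x with
  | some it =>
    rcases newest_drop (l := r.items i t) (x := x) hc with h1 | h1
    · rw [h1] at hn
      cases hn
    · rw [← h1, hn]
      exact Or.inl rfl
  | none =>
    rw [hn] at hev
    simp only at hev
    have hob : ∀ u b e v, u < t → r.event (b, u) = some e → e.memWrite = some (x, v) →
        b ≠ .disp i → r.OB (b, u) θ := fun u b e v hu hb he hne =>
      .trans _ _ _ (.of_memWrite_of_rfm hu hb he hev hne) (Run.lt_cut_iff.1 hi)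
    cases hn' : newest ((r.items i t).drop c') x with
    | none =>
      left
      simp only
      -- A missing store to `x` would be a propagation by `d_i`, and its entry would still be in the
      -- delayed buffer.
      rw [h.mem, ← hr.mem_eq_of_forall_ne (min_le_left t (r.memCut θ x))]
      intro u hu hut b e v hb he
      have hnob : ¬ r.OB (b, u) θ := by
        rw [← hr.lt_memCut_iff hb he]
        omega
      by_cases hne : b = .disp i
      · subst hne
        obtain ⟨it, h1, h2⟩ := hr.event_disp_of_le hut.le hb
        rw [he] at h2
        cases h2
        exact (newest_eq_none_iff _ _).1 hn' it
          (mem_drop_of_getElem? h1 (r.propCount_mono i (hq u hut hnob))) rfl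
      · exact hnob (hob u b e v hut hb he hne)
    | some it =>
      right
      refine ⟨x, it.val, it.idx, rfl, ?_⟩
      simp only
      congr 1
      obtain ⟨hmem, hx⟩ := mem_of_newest_eq_some hn'
      obtain ⟨k, hk, hitk⟩ := exists_getElem?_of_mem_drop hmem
      have hkc : k < r.propCount i t := by
        by_contra hkc
        exact (newest_eq_none_iff _ _).1 hn it (mem_drop_of_getElem? hitk (not_lt.1 hkc)) hx
      -- In `r` the entry was propagated at some `u < t`. It remains to see that this is the last
      -- store to `x` before `t`, so that memory holds its value at `t`.
      obtain ⟨u, hqu, hut, hu, e, he⟩ := r.exists_prop hk hkc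
      obtain ⟨it', h1, h2⟩ := hr.event_disp_of_le hut.le he
      rw [hu, hitk] at h1
      cases h1
      rw [hx] at h2
      rw [← hr.mem_succ he h2]
      apply hr.mem_eq_of_forall_ne hut
      intro u' huu' hu't b f v hb hf
      by_cases hne : b = .disp i
      · subst hne
        obtain ⟨it2, h3, h4⟩ := hr.event_disp_of_le hu't.le hb
        rw [hf] at h4
        cases h4
        have hlt : k + 1 ≤ r.propCount i u' := by
          refine le_trans ?_ (r.propCount_mono i huu')
          rw [Run.propCount, hu, he]
          simp
        have hmem2 := mem_drop_of_getElem? h3 hlt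
        rcases newest_drop (l := r.items i t) (x := it2.var) (show c' ≤ k + 1 by omega) with h5 | h5
        · exact (newest_eq_none_iff _ _).1 h5 it2 hmem2 rfl
        · rw [hn'] at h5
          obtain ⟨k', hk', h6⟩ := exists_getElem?_of_mem_drop (mem_of_newest_eq_some h5).1
          have := Run.items_idx h6
          have := Run.items_idx hitk
          omega
      -- A later store by another agent is in the past, and would draw the propagation at `u` into
      -- it.
      · have : u < r.cut θ (.disp i) := Run.lt_cut_iff.2
          (.trans _ _ _ (.of_memWrite huu' he hb h2 hf) (hob u' b f v hu't hb hf hne))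
        omega

/-- The past of `θ` can be performed on its own. -/
theorem Protocol.IsRun.imitates_of_past (hr : P.IsRun r) {t : ℕ} (h : r.Progress θ (min t) g') :
    Imitates (fun b => t < r.cut θ b) (r.joint t) (r.state t) g' where
  loc i hi := by rw [h.loc, min_eq_left hi.le]
  head i hi hp := hr.head_of_past h hi hp
  matches_event i α hi hα := by
    cases α
    case read x => exact hr.read_of_past h hi hα
    all_goals
      left
      simp only [procEvent, h.loc i, min_eq_left hi.le]
  enabled i α hi hα := by
    have hen := (hr.enabled t).act i α hα
    have hev := Run.event_proc hα
    have hempty : (r.state t).store.buf i = [] → (procEvent (r.state t) i α).IsSync →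
        g'.store.buf i = [] := by
      intro h1 h2
      rw [h.buf, min_eq_left hi.le, List.drop_eq_nil_iff]
      rw [(hr.buf_eq i t).1, List.drop_eq_nil_iff] at h1
      by_contra hlt
      -- A propagation missing in the delayed run would occur before this fence or
      -- read-modify-write, hence lie in the past.
      obtain ⟨u, hqu, hut, -, e, he⟩ := r.exists_prop le_rfl
        ((not_le.1 hlt).trans_le h1)
      obtain ⟨it, -, rfl⟩ := hr.event_disp he
      have : u < r.cut θ (.disp i) := Run.lt_cut_iff.2
        (.trans _ _ _ (.sync i u t _ _ hut he trivial hev h2) (Run.lt_cut_iff.1 hi))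
      omega
    cases α
    case fence => exact hempty hen trivial
    case rmw x ve vn =>
      refine ⟨hempty hen.1 trivial, ?_⟩
      -- The read-modify-write is itself a store to `x` in the past, so no earlier store to `x` is
      -- missing.
      have hw : t < r.memCut θ x := (hr.lt_memCut_iff hev rfl).2 (Run.lt_cut_iff.1 hi)
      rw [h.mem, min_eq_left hw.le]
      exact hen.2
    case ret ρ =>
      simp only [ActEnabled, h.loc i, min_eq_left hi.le] at hen ⊢
      exact hen
    all_goals trivial

/-- Now memory and the own dispatcher may be ahead of time `t`, but only by actions in the past.
Such an action, if it concerned the item or variable read, would have the read before it in the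
occurs-before order. -/
theorem Protocol.IsRun.read_of_rest (hr : P.IsRun r) (hsim : r.NoReadDuringProp) {t : ℕ}
    (h : r.Progress θ (max t) g') {i : Fin n} (hi : r.cut θ (.proc i) ≤ t) {x : Var}
    (hα : (r.joint t).act i = some (.read x)) :
    procEvent g' i (.read x) = procEvent (r.state t) i (.read x) := by
  have hev := Run.event_proc hα
  have hbuf' := h.buf i
  rw [max_eq_left hi] at hbuf'
  have hbuf := (hr.buf_eq i t).1
  have hnob : ¬ r.OB (.proc i, t) θ := by
    rw [← Run.lt_cut_iff]
    omega
  have hc : r.propCount i t ≤ r.propCount i (max t (r.cut θ (.disp i))) :=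
    r.propCount_mono i (le_max_left _ _)
  have hdrop := newest_drop (l := r.items i t) (x := x) hc
  simp only [procEvent, hbuf, hbuf'] at hev ⊢
  cases hn : newest ((r.items i t).drop (r.propCount i t)) x with
  | some it =>
    rw [hn] at hev hdrop
    rcases hdrop with h1 | h1
    · exfalso
      simp only at hev
      obtain ⟨hmem, hx⟩ := mem_of_newest_eq_some hn
      obtain ⟨k, hk, hitk⟩ := exists_getElem?_of_mem_drop hmem
      have hidx := Run.items_idx hitk
      have hkc : k < r.propCount i (max t (r.cut θ (.disp i))) := by
        by_contra hkc
        exact (newest_eq_none_iff _ _).1 h1 it (mem_drop_of_getElem? hitk (not_lt.1 hkc)) hx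
      obtain ⟨u, htu, hu, huk, e, he⟩ := r.exists_prop hk hkc
      obtain ⟨it', -, rfl⟩ := hr.event_disp he
      rw [huk, ← hidx] at he
      rcases htu.eq_or_lt with rfl | htu
      -- Occurs-before relates only different rounds, so a propagation of the item in the round of
      -- the read has to be excluded by hypothesis.
      · exact hsim i t _ _ _ _ _ ⟨hev, he⟩
      · exact hnob (.trans _ _ _ (.rfb_prop i t u _ _ _ _ _ htu hev he)
          (Run.lt_cut_iff.1 (by omega)))
    · rw [h1]
  | none =>
    rw [hn] at hev hdrop
    simp only at hev
    rw [or_self] at hdrop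
    rw [hdrop]
    simp only
    rw [h.mem, hr.mem_eq_of_forall_ne (le_max_left t (r.memCut θ x))]
    intro u htu hu b e v hb he
    have hob : r.OB (b, u) θ := (hr.lt_memCut_iff hb he).1 (by omega)
    obtain ⟨hacc, hnr⟩ := Event.access_of_memWrite he
    rcases htu.eq_or_lt with rfl | htu
    -- In the round of the read, the absence of conflicts leaves only `d_i` as storing agent, but
    -- the buffer of `i` has no entry for `x`.
    · by_cases hne : b = .disp i
      · subst hne
        obtain ⟨it, h1, h2⟩ := hr.event_disp_of_le le_rfl hb
        rw [he] at h2
        cases h2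
        exact (newest_eq_none_iff _ _).1 hn it (mem_drop_of_getElem? h1 le_rfl) rfl
      · refine (hr.enabled t).noConflict b (.proc i) e _ ?_ hb hev ⟨⟨x, hacc, rfl⟩, ?_, ?_⟩
        · rintro rfl
          exact hnob hob
        · exact fun hh => hnr hh.1
        · rintro ⟨j, ⟨h1, h2, -⟩ | ⟨h1, -⟩⟩
          · cases h2
            exact hne h1
          · cases h1
    · refine hnob (.trans _ _ _ (.memory _ _ t u x _ _ htu hev hb rfl hacc (fun hh => hnr hh.2) ?_)
        hob)
      rintro ⟨j, h1, -⟩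
      cases h1

/-- After the past of `θ`, the other actions can be performed as in `r`. -/
theorem Protocol.IsRun.imitates_of_rest (hr : P.IsRun r) (hsim : r.NoReadDuringProp) {t : ℕ}
    (h : r.Progress θ (max t) g') :
    Imitates (fun b => r.cut θ b ≤ t) (r.joint t) (r.state t) g' where
  loc i hi := by rw [h.loc, max_eq_left hi]
  head i hi hp := by
    obtain ⟨e, he⟩ := hr.event_of_prop hp
    obtain ⟨it, hit, -⟩ := hr.event_disp he
    rw [h.buf, (hr.buf_eq i t).1, List.head?_drop, List.head?_drop, max_eq_left hi]
    exact hr.items_getElem? i (le_max_left _ _) (List.getElem?_eq_some_iff.1 hit).1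
  matches_event i α hi hα := by
    left
    cases α
    case read x => exact hr.read_of_rest hsim h hi hα
    all_goals simp only [procEvent, h.loc i, max_eq_left hi]
  enabled i α hi hα := by
    have hen := (hr.enabled t).act i α hα
    have hev := Run.event_proc hα
    have hempty : (r.state t).store.buf i = [] → g'.store.buf i = [] := by
      intro h1
      rw [h.buf, max_eq_left hi, List.drop_eq_nil_iff]
      rw [(hr.buf_eq i t).1, List.drop_eq_nil_iff] at h1
      exact h1.trans (r.propCount_mono i (le_max_left _ _))
    cases α
    case fence => exact hempty hen
    case rmw x ve vn =>
      refine ⟨hempty hen.1, ?_⟩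
      have hw : ¬ t < r.memCut θ x := by
        rw [hr.lt_memCut_iff hev rfl, ← Run.lt_cut_iff]
        omega
      rw [h.mem, max_eq_left (not_lt.1 hw)]
      exact hen.2
    case ret ρ =>
      simp only [ActEnabled, h.loc i, max_eq_left hi] at hen ⊢
      exact hen
    all_goals trivial

end Imitation

/-! ### The delayed run and its operations. -/

section Delay

variable {n : ℕ} {Var Val Lab Op Resp : Type*} [DecidableEq Var]
  {g' : GState n Var Val Lab Op Resp}
  {P : Protocol n Var Val Lab Op Resp} {r : Run n Var Val Lab Op Resp} {θ : Node n}

/-- One induction step for both phases: `f = min t` with `active p` meaning `t < p`, then `f = max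
t` with `p ≤ t`. By `hw`, the clock of a variable advances exactly when the agent storing to it
acts. -/
theorem Protocol.IsRun.progress_next (hr : P.IsRun r) {f f' : ℕ → ℕ} {t : ℕ} {active : ℕ → Prop}
    (h : r.Progress θ f g')
    (hi : Imitates (fun b => active (r.cut θ b)) (r.joint t) (r.state t) g')
    (hf : ∀ p, active p → f p = t ∧ f' p = t + 1) (hf' : ∀ p, ¬ active p → f' p = f p)
    (hw : ∀ b e x v, r.event (b, t) = some e → e.memWrite = some (x, v) →
      (active (r.memCut θ x) ↔ active (r.cut θ b))) :
    r.Progress θ f' (next g' ((r.joint t).restrict fun b => active (r.cut θ b))) := by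
  have hitems : ∀ i, r.items i (f' (r.cut θ (.proc i))) = r.items i (f (r.cut θ (.proc i))) ++
      writtenOf (eventOf g' ((r.joint t).restrict fun b => active (r.cut θ b)) (.proc i)) := by
    intro i
    by_cases ha : active (r.cut θ (.proc i))
    · rw [(hf _ ha).1, (hf _ ha).2, hr.items_succ, hi.writtenOf_eq ha]
      rfl
    · rw [hf' _ ha, eventOf_restrict_of_not ha]
      simp [writtenOf]
  have hcount : ∀ i, r.propCount i (f' (r.cut θ (.disp i))) =
      r.propCount i (f (r.cut θ (.disp i))) +
      if (eventOf g' ((r.joint t).restrict fun b => active (r.cut θ b)) (.disp i)).isSome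
        then 1 else 0 := by
    intro i
    by_cases ha : active (r.cut θ (.disp i))
    · rw [(hf _ ha).1, (hf _ ha).2, Run.propCount, hi.eventOf_disp ha]
      rfl
    · rw [hf' _ ha, eventOf_restrict_of_not ha]
      simp
  refine ⟨fun i => ?_, fun i => ?_, fun i => ?_, fun x => ?_⟩
  · by_cases ha : active (r.cut θ (.proc i))
    · rw [hi.next_loc ha, (hf _ ha).2, hr.state_succ]
    · rw [next_loc_restrict_of_not ha, hf' _ ha, h.loc]
  · rw [hitems, hcount]
    exact (next_buf_eq_drop (h.buf i) (h.le i)).1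
  · rw [hitems, hcount]
    exact (next_buf_eq_drop (h.buf i) (h.le i)).2
  · by_cases ha : active (r.memCut θ x)
    · rw [(hf _ ha).2, hr.state_succ]
      refine hi.next_mem (hr.enabled t) ?_ fun b e v hb he => (hw b e x v hb he).1 ha
      rw [h.mem, (hf _ ha).1]
    · rw [hf' _ ha, ← h.mem]
      exact hi.next_mem_of_not fun b e v hb he hA => ha ((hw b e x v hb he).2 hA)

/-- The joint actions of `r` with all actions outside the past of `θ` delayed until after `θ`. -/
noncomputable def Run.delayedJoint (r : Run n Var Val Lab Op Resp) (θ : Node n) (s : ℕ) :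
    JointAction n Var Val Lab Op Resp :=
  -- Cuts are at most `θ.2`, so round `θ.2` is idle. It makes the delayed part start strictly later
  -- than time `θ.2`, as `Run.Precedes` demands.
  if s < θ.2 + 1 then (r.joint s).restrict fun b => s < r.cut θ b
  else (r.joint (s - (θ.2 + 1))).restrict fun b => r.cut θ b ≤ s - (θ.2 + 1)

theorem Run.delayedJoint_of_lt {s : ℕ} (hs : s < θ.2 + 1) :
    r.delayedJoint θ s = (r.joint s).restrict fun b => s < r.cut θ b :=
  if_pos hs

theorem Run.delayedJoint_add (t : ℕ) :
    r.delayedJoint θ (θ.2 + 1 + t) = (r.joint t).restrict fun b => r.cut θ b ≤ t := by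
  rw [Run.delayedJoint, if_neg (by omega), Nat.add_sub_cancel_left]

/-- The run `r` with all actions outside the past of `θ` delayed until after `θ`. -/
noncomputable def Run.delayed (r : Run n Var Val Lab Op Resp) (θ : Node n) :
    Run n Var Val Lab Op Resp where
  state := Nat.rec (r.state 0) fun s g => next g (r.delayedJoint θ s)
  joint := r.delayedJoint θ

theorem Protocol.IsRun.progress_past (hr : P.IsRun r) {s : ℕ} (hs : s ≤ θ.2 + 1) :
    r.Progress θ (min s) ((r.delayed θ).state s) := by
  induction s with
  | zero =>
    simp only [Run.delayed]
    constructor <;> simp [(hr.buf_eq _ 0).1, Run.propCount]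
  | succ s ih =>
    have hp := ih (by omega)
    have := hr.progress_next (f' := min (s + 1)) hp (hr.imitates_of_past hp)
      (fun p hp => by omega) (fun p hp => by omega)
      (fun b e x v hb he => by rw [hr.lt_memCut_iff hb he, Run.lt_cut_iff])
    rw [← Run.delayedJoint_of_lt (by omega)] at this
    exact this

theorem Protocol.IsRun.progress_rest (hr : P.IsRun r) (hsim : r.NoReadDuringProp) (t : ℕ) :
    r.Progress θ (max t) ((r.delayed θ).state (θ.2 + 1 + t)) := by
  induction t with
  | zero =>
    have h := hr.progress_past (θ := θ) le_rfl
    -- The past is complete at the changeover: both phases describe the state by the bare cuts.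
    have h1 : ∀ b, min (θ.2 + 1) (r.cut θ b) = max 0 (r.cut θ b) := fun b => by
      have := Run.cut_le (r := r) θ b
      omega
    have h2 : ∀ x, min (θ.2 + 1) (r.memCut θ x) = max 0 (r.memCut θ x) := fun x => by
      have := Run.memCut_le (r := r) θ x
      omega
    refine ⟨fun i => ?_, fun i => ?_, fun i => ?_, fun x => ?_⟩
    · rw [← h1]
      exact h.loc i
    · rw [← h1, ← h1]
      exact h.buf i
    · rw [← h1, ← h1]
      exact h.le i
    · rw [← h2]
      exact h.mem x
  | succ t ih =>
    have := hr.progress_next (f' := max (t + 1)) (active := fun p => p ≤ t) ih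
      (hr.imitates_of_rest hsim ih) (fun p hp => by omega) (fun p hp => by omega)
      (fun b e x v hb he => by
        rw [← not_lt, ← not_lt, hr.lt_memCut_iff hb he, Run.lt_cut_iff])
    rw [← Run.delayedJoint_add] at this
    exact this

/-- Every round of the delayed run performs a part of the actions of some round of `r`. -/
theorem Protocol.IsRun.delayed_imitates (hr : P.IsRun r) (hsim : r.NoReadDuringProp)
    (θ : Node n) (s : ℕ) : ∃ t A, Imitates A (r.joint t) (r.state t) ((r.delayed θ).state s) ∧
      (r.delayed θ).joint s = (r.joint t).restrict A := by
  by_cases hs : s < θ.2 + 1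
  · exact ⟨s, _, hr.imitates_of_past (hr.progress_past hs.le), Run.delayedJoint_of_lt hs⟩
  · obtain ⟨t, rfl⟩ := Nat.exists_eq_add_of_le (not_lt.1 hs)
    exact ⟨t, _, hr.imitates_of_rest hsim (hr.progress_rest hsim t), Run.delayedJoint_add t⟩

/-- Idling is always possible, since `follows` restricts only non-null actions. Every other action
is taken in the same local state as in `r`. -/
theorem Protocol.IsRun.delayed (hr : P.IsRun r) (hsim : r.NoReadDuringProp) (θ : Node n) :
    P.IsRun (r.delayed θ) where
  mem_zero := hr.mem_zero
  buf_zero := hr.buf_zero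
  loc_zero := hr.loc_zero
  enabled s := by
    obtain ⟨t, A, h1, h2⟩ := hr.delayed_imitates hsim θ s
    rw [h2]
    exact h1.enabled_restrict (hr.enabled t)
  state_succ _ := rfl
  follows s i α hα := by
    obtain ⟨t, A, h1, h2⟩ := hr.delayed_imitates hsim θ s
    rw [h2] at hα
    by_cases hA : A (.proc i)
    · simp only [JointAction.restrict, hA, if_true] at hα
      rw [h1.loc i hA]
      exact hr.follows t i α hα
    · simp [JointAction.restrict, hA] at hα

/-! ### Operations of the delayed run -/

theorem Run.isOp_of_delayed {X : OpId n} {o : Op} (h : (r.delayed θ).IsOp X o) :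
    ∃ t, r.IsOp ⟨X.proc, t⟩ o ∧ ((X.start = t ∧ t < r.cut θ (.proc X.proc)) ∨
      (X.start = θ.2 + 1 + t ∧ r.cut θ (.proc X.proc) ≤ t)) := by
  have h' : (r.delayedJoint θ X.start).inv X.proc = some o := h
  by_cases hs : X.start < θ.2 + 1
  · rw [Run.delayedJoint_of_lt hs] at h'
    by_cases hc : X.start < r.cut θ (.proc X.proc)
    · simp only [JointAction.restrict, hc, if_true] at h'
      exact ⟨X.start, h', Or.inl ⟨rfl, hc⟩⟩
    · simp [JointAction.restrict, hc] at h'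
  · obtain ⟨t, ht⟩ := Nat.exists_eq_add_of_le (not_lt.1 hs)
    rw [ht, Run.delayedJoint_add] at h'
    by_cases hc : r.cut θ (.proc X.proc) ≤ t
    · simp only [JointAction.restrict, hc, if_true] at h'
      exact ⟨t, h', Or.inr ⟨ht, hc⟩⟩
    · simp [JointAction.restrict, hc] at h'

theorem Run.delayed_past (i : Fin n) {t : ℕ} (ht : t < r.cut θ (.proc i)) :
    ((r.delayed θ).joint t).inv i = (r.joint t).inv i ∧
      ((r.delayed θ).joint t).act i = (r.joint t).act i := by
  have := Run.cut_le (r := r) θ (.proc i)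
  have h : (r.delayed θ).joint t = _ := Run.delayedJoint_of_lt (show t < θ.2 + 1 by omega)
  rw [h]
  simp [JointAction.restrict, ht]

theorem Run.delayed_rest (i : Fin n) {t : ℕ} (ht : r.cut θ (.proc i) ≤ t) :
    ((r.delayed θ).joint (θ.2 + 1 + t)).inv i = (r.joint t).inv i ∧
      ((r.delayed θ).joint (θ.2 + 1 + t)).act i = (r.joint t).act i := by
  have h : (r.delayed θ).joint (θ.2 + 1 + t) = _ := Run.delayedJoint_add t
  rw [h]
  simp [JointAction.restrict, ht]

theorem Run.isOp_delayed_past {X : OpId n} {o : Op} (h : r.IsOp X o)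
    (hX : X.start < r.cut θ (.proc X.proc)) : (r.delayed θ).IsOp X o := by
  rw [Run.IsOp, (Run.delayed_past _ hX).1]
  exact h

theorem Run.isOp_delayed_rest {X : OpId n} {o : Op} (h : r.IsOp X o)
    (hX : r.cut θ (.proc X.proc) ≤ X.start) :
    (r.delayed θ).IsOp ⟨X.proc, θ.2 + 1 + X.start⟩ o := by
  rw [Run.IsOp, (Run.delayed_rest _ hX).1]
  exact h

theorem Run.endsWith_delayed_past {X : OpId n} {e : ℕ} {ρ : Resp} (h : r.EndsWith X e ρ)
    (hX : e - 1 < r.cut θ (.proc X.proc)) :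
    (r.delayed θ).EndsWith X e ρ := by
  obtain ⟨⟨o, ho⟩, u, rfl, hu, hret, hfirst⟩ := h
  refine ⟨⟨o, Run.isOp_delayed_past ho (by omega)⟩, u, rfl, hu, ?_, fun w ρ' h1 h2 => ?_⟩
  · rw [(Run.delayed_past _ (by omega)).2]
    exact hret
  · rw [(Run.delayed_past _ (by omega)).2]
    exact hfirst w ρ' h1 h2

theorem Run.endsWith_delayed_rest {X : OpId n} {e : ℕ} {ρ : Resp} (h : r.EndsWith X e ρ)
    (hX : r.cut θ (.proc X.proc) ≤ X.start) :
    (r.delayed θ).EndsWith ⟨X.proc, θ.2 + 1 + X.start⟩ (θ.2 + 1 + e) ρ := by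
  obtain ⟨⟨o, ho⟩, u, rfl, hu, hret, hfirst⟩ := h
  refine ⟨⟨o, Run.isOp_delayed_rest ho hX⟩, θ.2 + 1 + u, rfl, Nat.add_lt_add_left hu _, ?_,
    fun w ρ' h1 h2 => ?_⟩
  · rw [(Run.delayed_rest X.proc (by omega)).2]
    exact hret
  · simp only at h1
    obtain ⟨t, rfl⟩ := Nat.exists_eq_add_of_le (show θ.2 + 1 ≤ w by omega)
    rw [(Run.delayed_rest X.proc (by omega)).2]
    exact hfirst t ρ' (by omega) (by omega)

end Delay

/-! ### Views of scans in linearizable runs. -/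

section Snapshot

variable {n : ℕ} {Var Val Lab W : Type*}

theorem lastUpdate_concat (h : List (Fin n × SnapOp W × SnapResp n W))
    (e : Fin n × SnapOp W × SnapResp n W) (k : Fin n) :
    lastUpdate (h ++ [e]) k = (lastUpdate [e] k).or (lastUpdate h k) := by
  simp [lastUpdate, List.filterMap_append, List.getLast?_append]

theorem exists_of_lastUpdate_eq_some {l : List (LinEntry n (SnapOp W) (SnapResp n W))}
    {k : Fin n} {w : W}
    (h : lastUpdate (l.map fun a => (a.id.proc, a.op, a.resp)) k = some w) :
    ∃ a ∈ l, a.id.proc = k ∧ a.op = .update w := by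
  have h1 := List.mem_of_getLast? h
  simp only [List.mem_filterMap, List.mem_map] at h1
  obtain ⟨_, ⟨a, ha, rfl⟩, h2⟩ := h1
  refine ⟨a, ha, ?_⟩
  rcases a with ⟨id, op, resp⟩
  cases op <;> simp_all

/-- A linearization respects the order of each process, so an update that comes later in it also
started later. -/
theorem lastUpdate_of_mem {l : List (LinEntry n (SnapOp W) (SnapResp n W))}
    (hl : l.Pairwise fun a b => a.id.proc = b.id.proc → a.id.start < b.id.start)
    {a : LinEntry n (SnapOp W) (SnapResp n W)} (ha : a ∈ l) {v : W} (hv : a.op = .update v) :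
    ∃ b ∈ l, ∃ w, lastUpdate (l.map fun a => (a.id.proc, a.op, a.resp)) a.id.proc = some w ∧
      b.id.proc = a.id.proc ∧ b.op = .update w ∧ a.id.start ≤ b.id.start := by
  induction l using List.reverseRecOn with
  | nil => cases ha
  | append_singleton l c ih =>
    rw [List.pairwise_append] at hl
    rw [List.map_append, List.map_singleton, lastUpdate_concat]
    by_cases hc : c.id.proc = a.id.proc ∧ ∃ w, c.op = .update w
    · obtain ⟨h1, w, h2⟩ := hc
      refine ⟨c, by simp, w, by simp [lastUpdate, h1, h2], h1, h2, ?_⟩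
      rcases List.mem_append.1 ha with ha | ha
      · exact (hl.2.2 a ha c (by simp) h1.symm).le
      · rw [List.mem_singleton.1 ha]
    · have hal : a ∈ l := by
        rcases List.mem_append.1 ha with ha | ha
        · exact ha
        · rw [List.mem_singleton.1 ha] at hv hc
          exact absurd ⟨rfl, v, hv⟩ hc
      obtain ⟨b, hb, w, h1, h2⟩ := ih hl.1 hal
      refine ⟨b, List.mem_append_left _ hb, w, ?_, h2⟩
      have : lastUpdate [(c.id.proc, c.op, c.resp)] a.id.proc = none := by
        rcases c with ⟨id, op, resp⟩
        cases op <;> simp_all [lastUpdate]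
      rw [this, h1]
      rfl

/-- The views returned by scans in linearizable runs. -/
theorem Run.scan_view {r : Run n Var Val Lab (SnapOp W) (SnapResp n W)}
    (hlin : ∀ T, r.LinearizableUpTo (snapshotSpec n W) T) {X : OpId n} {e : ℕ}
    {ρ : SnapResp n W} (hX : r.IsOp X .scan) (he : r.EndsWith X e ρ) :
    ∃ V : Fin n → Option W, ρ = .view V ∧
      (∀ k w, V k = some w → ∃ Z, r.IsOp Z (.update w) ∧ Z.proc = k ∧ ¬ r.Precedes X Z) ∧
      (∀ Y v, r.IsOp Y (.update v) → r.Precedes Y X →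
        ∃ w Z, V Y.proc = some w ∧ r.IsOp Z (.update w) ∧ Z.proc = Y.proc ∧
          Y.start ≤ Z.start) := by
  -- Cutting the history at the end of the scan makes the scan, and every operation preceding it,
  -- complete in it.
  obtain ⟨L, hop, hresp, hcompl, -, horder, hprec, hspec⟩ := hlin e
  obtain ⟨a, ha, rfl⟩ := hcompl X e ρ he le_rfl
  obtain ⟨l₁, l₂, rfl⟩ := List.append_of_mem ha
  have hro := hresp a ha e ρ he le_rfl
  have hao : a.op = .scan := by
    have := (hop a ha).2
    rw [Run.IsOp] at this hX
    rw [hX] at this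
    exact (Option.some.inj this).symm
  rw [List.pairwise_append] at horder hprec
  have hview := hspec (l₁.map fun a => (a.id.proc, a.op, a.resp))
    (l₂.map fun a => (a.id.proc, a.op, a.resp)) a.id.proc a.op a.resp (by simp)
  rw [hao] at hview
  simp only at hview
  refine ⟨_, hro.symm.trans hview, fun k w hw => ?_, fun Y v hY hYX => ?_⟩
  · obtain ⟨b, hb, h1, h2⟩ := exists_of_lastUpdate_eq_some hw
    refine ⟨b.id, ?_, h1, hprec.2.2 b hb a (by simp)⟩
    rw [← h2]
    exact (hop b (List.mem_append_left _ hb)).2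
  · obtain ⟨-, eY, ρY, hYe, hlt⟩ := id hYX
    have hle : eY ≤ e := by
      obtain ⟨-, u, rfl, hu, -⟩ := he
      omega
    obtain ⟨y, hy, rfl⟩ := hcompl Y eY ρY hYe hle
    have hyo : y.op = .update v := by
      have := (hop y hy).2
      rw [Run.IsOp] at this hY
      rw [hY] at this
      exact (Option.some.inj this).symm
    have hyl : y ∈ l₁ := by
      rcases List.mem_append.1 hy with h | h
      · exact h
      · rcases List.mem_cons.1 h with rfl | h
        · rw [hao] at hyo
          cases hyo
        · exact absurd hYX ((List.pairwise_cons.1 hprec.2.1).1 y h)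
    obtain ⟨b, hb, w, h1, h2, h3, h4⟩ := lastUpdate_of_mem horder.1 hyl hyo
    refine ⟨w, b.id, h1, ?_, h2, h4⟩
    rw [← h3]
    exact (hop b (List.mem_append_left _ hb)).2

variable [DecidableEq Var] {r : Run n Var Val Lab (SnapOp W) (SnapResp n W)}

/-- Each operation of `r` has a single place in the delayed run, as its start is either below the
cut of its process or not. -/
theorem Run.DistinctUpdates.delayed (h : r.DistinctUpdates) (θ : Node n) :
    (r.delayed θ).DistinctUpdates := by
  intro X Y w hXY hX hY
  obtain ⟨s, hs, hs'⟩ := Run.isOp_of_delayed hX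
  obtain ⟨t, ht, ht'⟩ := Run.isOp_of_delayed hY
  have hst : s = t := h ⟨X.proc, s⟩ ⟨Y.proc, t⟩ w hXY hs ht
  rw [← hXY] at ht'
  omega

end Snapshot

end TSO

/-! ### The two contradictions between `r` and the delayed run. -/

theorem mainTheorem7 {n : ℕ} {Var Val Lab W : Type*} [DecidableEq Var]
    (P : TSO.Protocol n Var Val Lab (TSO.SnapOp W) (TSO.SnapResp n W))
    (hP : P.IsLinearizableSnapshot)
    (r : TSO.Run n Var Val Lab (TSO.SnapOp W) (TSO.SnapResp n W))
    (hr : P.IsRun r) (hdistinct : r.DistinctUpdates) (hsim : r.NoReadDuringProp) :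
    (∀ (X Y : TSO.OpId n) (v : W), r.IsOp X (.update v) → r.IsOp Y .scan →
      r.Precedes X Y → r.Completes Y → r.OpOB X Y) ∧
    (∀ (X Y : TSO.OpId n) (v : W), r.IsOp X .scan → r.IsOp Y (.update v) →
      r.Precedes X Y → r.Completes Y → r.OpOB X Y) := by
  have hlin := hP r hr hdistinct
  have hlin' := fun θ => hP _ (hr.delayed hsim θ) (hdistinct.delayed θ)
  -- The return happens in round `e - 1`, so by locality it belongs to the past of the final node,
  -- as does the invocation.
  have hcut : ∀ (Y : TSO.OpId n) e ρ, r.EndsWith Y e ρ →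
      e - 1 < r.cut (.proc Y.proc, e) (.proc Y.proc) ∧
        Y.start < r.cut (.proc Y.proc, e) (.proc Y.proc) := by
    rintro Y _ ρ ⟨-, u, rfl, hu, -⟩
    exact ⟨TSO.Run.lt_cut_iff.2 (.locality _ _ _ (by omega)),
      TSO.Run.lt_cut_iff.2 (.locality _ _ _ (by omega))⟩
  constructor
  · rintro X Y v hX hY hXY ⟨e, ρ, hYe⟩
    refine ⟨⟨_, hX⟩, e, ρ, hYe, ?_⟩
    by_contra hn
    rw [← TSO.Run.lt_cut_iff, not_lt] at hn
    obtain ⟨h1, h2⟩ := hcut Y e ρ hYe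
    obtain ⟨V, rfl, -, hV⟩ := TSO.Run.scan_view hlin hY hYe
    obtain ⟨w, Z, hVw, hZ, hZp, hXZ⟩ := hV X v hX hXY
    have hYe' := TSO.Run.endsWith_delayed_past hYe h1
    obtain ⟨V', hVV, hV', -⟩ :=
      TSO.Run.scan_view (hlin' _) (TSO.Run.isOp_delayed_past hY h2) hYe'
    cases hVV
    obtain ⟨Z', hZ', hZp', hYZ⟩ := hV' _ _ hVw
    obtain ⟨t, ht, ht'⟩ := TSO.Run.isOp_of_delayed hZ'
    -- The process updates with `w` only once, so `Z'` is the copy of `Z`.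
    have htZ : t = Z.start := hdistinct ⟨Z'.proc, t⟩ _ w (hZp'.trans hZp.symm) ht hZ
    rw [hZp'] at ht'
    simp only at ht'
    -- `Z` starts no earlier than `X`, hence beyond the cut of their process, so its copy starts at
    -- `e + 1` or later.
    exact hYZ ⟨⟨_, hZ'⟩, _, _, hYe', by omega⟩
  · rintro X Y v hX hY ⟨-, eX, ρX, hXe, hXY⟩ ⟨e, ρ, hYe⟩
    refine ⟨⟨_, hX⟩, e, ρ, hYe, ?_⟩
    by_contra hn
    rw [← TSO.Run.lt_cut_iff, not_lt] at hn
    obtain ⟨h1, h2⟩ := hcut Y e ρ hYe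
    obtain ⟨V, rfl, hV, -⟩ := TSO.Run.scan_view hlin hX hXe
    have hYe' := TSO.Run.endsWith_delayed_past hYe h1
    have hX' := TSO.Run.isOp_delayed_rest hX hn
    obtain ⟨V', hVV, -, hV'⟩ :=
      TSO.Run.scan_view (hlin' _) hX' (TSO.Run.endsWith_delayed_rest hXe hn)
    cases hVV
    obtain ⟨w, Z', hVw, hZ', hZp', hYZ⟩ := hV' Y v (TSO.Run.isOp_delayed_past hY h2)
      ⟨⟨_, hX'⟩, _, _, hYe', by simp only; omega⟩
    obtain ⟨t, ht, ht'⟩ := TSO.Run.isOp_of_delayed hZ'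
    obtain ⟨Z, hZ, hZp, hXZ⟩ := hV _ _ hVw
    have htZ : t = Z.start := hdistinct ⟨Z'.proc, t⟩ _ w (hZp'.trans hZp.symm) ht hZ
    rw [hZp'] at ht'
    simp only at ht'
    -- If `Z'` kept its time, then `Z` starts no earlier than `Y`. If it was shifted, `Z` starts
    -- beyond the cut, which exceeds the start of `Y`. Either way the scan ended before.
    exact hXZ ⟨⟨_, hZ⟩, _, _, hXe, by omega⟩
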